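/- Throughout, $\#\mathrm{P}^A$ is the class of functions $f:\{0,1\}^*\to\mathbb N$ for which there is a nondeterministic polynomial-time oracle Turing machine $M$ such that $f(w)$ is the number of accepting computation paths of $M^A$ on input $w$; $\#\mathrm{P}=\#\mathrm{P}^{\varnothing}$, and $\#\mathrm{P}^{\mathrm{NP}}=\bigcup_{B\in\mathrm{NP}}\#\mathrm{P}^B$. A polynomial $\varphi\in\mathbb Q[x]$ is a closure property of a class $\mathcal C$ of such functions if $\varphi\circ f\in\mathcal C$ for every $f\in\mathcal C$; a closure property of $\#\mathrm{P}$ relativizes if it is a closure property of $\#\mathrm{P}^A$ for every language $A\subseteq\{0,1\}^*$. The univariate binomial basis conjecture says that every univariate polynomial closure property of $\#\mathrm{P}$ relativizes. A polynomial $\varphi\in\mathbb Q[x]$ is binomial-bad if its coefficients over the basis $\binom{x}{0},\binom{x}{1},\binom{x}{2},\dots$ of $\mathbb Q[x]$ are not all nonnegative integers. Theorem. The univariate binomial basis conjecture implies $\#\mathrm{P}\neq\#\mathrm{P}^{\mathrm{NP}}$, and it implies $\mathrm{P}\neq\mathrm{NP}$. Moreover, if $\#\mathrm{P}=\#\mathrm{P}^{\mathrm{NP}}$,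 then $\binom{x-1}{2}=\frac{(x-1)(x-2)}{2}$ is a closure property of $\#\mathrm{P}$; and this polynomial is binomial-bad. -/

import Mathlib

open Polynomial

noncomputable section

namespace CountingComplexity

/-! ### Nondeterministic multi-tape Turing machines with oracle access -/

/-- Head movements. -/
inductive Shift
  | left
  | stay
  | right

/-- The displacement of the head belonging to a head movement. -/
def Shift.toInt : Shift → ℤ
  | .left => -1
  | .stay => 0
  | .right => 1

/-- A tape, infinite in both directions, over the alphabet `0`, `1`, blank; blank is `none`. -/
abbrev Tape : Type := ℤ → Option Bool

/-- The tape that has the word `w` in the cells `0, 1, …, |w| - 1` and is blank elsewhere. -/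
def Tape.ofWord (w : List Bool) : Tape
  | Int.ofNat n => w[n]?
  | Int.negSucc _ => none

/-- `t.Holds y`: the longest blank-free word on the tape `t` that starts in cell `0` is `y`
(for `i = |y|` the condition says that cell `|y|` is blank). -/
def Tape.Holds (t : Tape) (y : List Bool) : Prop :=
  ∀ i : ℕ, i ≤ y.length → t (i : ℤ) = y[i]?

/-- What a machine with tapes `K` and states `Q` does in one step: it halts and accepts or rejects,
it writes a symbol on every tape and moves every head, it makes a nondeterministic binary
choice, or it asks the oracle about the word on its query tape. -/
inductive Action (K Q : Type)
  | accept
  | reject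
  | move (q : Q) (write : K → Option Bool) (shift : K → Shift)
  | choose (q : Bool → Q)
  | query (q : Bool → Q)

/-- A nondeterministic oracle Turing machine with finitely many tapes and states. The action
taken depends on the state and on the symbols under the heads. -/
structure OracleNTM where
  /-- the tapes -/
  K : Type
  /-- the states -/
  Q : Type
  /-- there are finitely many tapes -/
  finiteK : Finite K
  /-- there are finitely many states -/
  finiteQ : Finite Q
  /-- the tape on which the input is given -/
  inputTape : K
  /-- the tape on which oracle queries are written -/
  queryTape : K
  /-- the initial state -/
  start : Q
  /-- the transition function -/
  δ : Q → (K → Option Bool) → Action K Q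

/-- The result of one step from a configuration, for configurations of type `C`. -/
inductive Outcome (C : Type)
  | accept
  | reject
  | next (c : C)
  | branch (c : Bool → C)

namespace OracleNTM

/-- Configurations: state, head positions, tape contents. -/
structure Cfg (M : OracleNTM) where
  /-- the current state -/
  state : M.Q
  /-- the positions of the heads -/
  head : M.K → ℤ
  /-- the contents of the tapes -/
  tape : M.K → Tape

open Classical in
/-- The initial configuration on input `w`. -/
def init (M : OracleNTM) (w : List Bool) : M.Cfg where
  state := M.start
  head := fun _ => 0
  tape := fun k => if k = M.inputTape then Tape.ofWord w else Tape.ofWord []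

open Classical in
/-- The answer of the oracle `A` in configuration `c`: is the word on the query tape in `A`? -/
def answer (M : OracleNTM) (A : Set (List Bool)) (c : M.Cfg) : Bool :=
  decide (∃ y ∈ A, (c.tape M.queryTape).Holds y)

/-- One step of the computation with oracle `A`. -/
def step (M : OracleNTM) (A : Set (List Bool)) (c : M.Cfg) : Outcome M.Cfg :=
  match M.δ c.state (fun k => c.tape k (c.head k)) with
  | .accept => .accept
  | .reject => .reject
  | .move q write shift => .next
      { state := q
        head := fun k => c.head k + (shift k).toInt
        tape := fun k => Function.update (c.tape k) (c.head k) (write k) }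
  | .choose q => .branch fun b => { c with state := q b }
  | .query q => .next { c with state := q (M.answer A c) }

/-- `M.AcceptsAlong A c y`: the computation from `c` with oracle `A` whose sequence of
nondeterministic choice bits is exactly `y` halts and accepts. -/
inductive AcceptsAlong (M : OracleNTM) (A : Set (List Bool)) : M.Cfg → List Bool → Prop
  | halt {c : M.Cfg} (h : M.step A c = .accept) : AcceptsAlong M A c []
  | next {c c' : M.Cfg} {y : List Bool} (h : M.step A c = .next c')
      (h' : AcceptsAlong M A c' y) : AcceptsAlong M A c y
  | branch {c : M.Cfg} {d : Bool → M.Cfg} {y : List Bool} (h : M.step A c = .branch d)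
      (b : Bool) (h' : AcceptsAlong M A (d b) y) : AcceptsAlong M A c (b :: y)

/-- `M.HaltsWithin A t c`: every computation path from `c` with oracle `A` halts after at most
`t` steps. -/
inductive HaltsWithin (M : OracleNTM) (A : Set (List Bool)) : ℕ → M.Cfg → Prop
  | accept {t : ℕ} {c : M.Cfg} (h : M.step A c = .accept) : HaltsWithin M A t c
  | reject {t : ℕ} {c : M.Cfg} (h : M.step A c = .reject) : HaltsWithin M A t c
  | next {t : ℕ} {c c' : M.Cfg} (h : M.step A c = .next c')
      (h' : HaltsWithin M A t c') : HaltsWithin M A (t + 1) c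
  | branch {t : ℕ} {c : M.Cfg} {d : Bool → M.Cfg} (h : M.step A c = .branch d)
      (h' : ∀ b, HaltsWithin M A t (d b)) : HaltsWithin M A (t + 1) c

/-- The machine runs in polynomial time: there is a polynomial that bounds, independently of the
oracle, the length of all computation paths in terms of the length of the input. -/
def PolyTime (M : OracleNTM) : Prop :=
  ∃ p : ℕ[X], ∀ (A : Set (List Bool)) (w : List Bool),
    M.HaltsWithin A (p.eval w.length) (M.init w)

/-- The machine never makes a nondeterministic choice. -/
def Deterministic (M : OracleNTM) : Prop :=
  ∀ (q : M.Q) (s : M.K → Option Bool) (r : Bool → M.Q), M.δ q s ≠ .choose r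

/-- The number of accepting paths on input `w` with oracle `A`. -/
def numAcc (M : OracleNTM) (A : Set (List Bool)) (w : List Bool) : ℕ :=
  {y : List Bool | M.AcceptsAlong A (M.init w) y}.ncard

end OracleNTM

/-! ### Complexity classes -/

/-- The class `#P^A` of counting functions. -/
def SharpPRel (A : Set (List Bool)) : Set (List Bool → ℕ) :=
  {f | ∃ M : OracleNTM, M.PolyTime ∧ ∀ w, f w = M.numAcc A w}

/-- The class `#P`; a machine gains nothing from the empty oracle, which always answers no. -/
def SharpP : Set (List Bool → ℕ) := SharpPRel ∅

/-- The class `NP`. -/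
def ClassNP : Set (Set (List Bool)) :=
  {L | ∃ M : OracleNTM, M.PolyTime ∧ ∀ w, w ∈ L ↔ ∃ y, M.AcceptsAlong ∅ (M.init w) y}

/-- The class `P`. -/
def ClassP : Set (Set (List Bool)) :=
  {L | ∃ M : OracleNTM, M.Deterministic ∧ M.PolyTime ∧
    ∀ w, w ∈ L ↔ ∃ y, M.AcceptsAlong ∅ (M.init w) y}

/-- The class `#P^NP`. -/
def SharpPNP : Set (List Bool → ℕ) :=
  {f | ∃ B ∈ ClassNP, f ∈ SharpPRel B}

/-! ### Closure properties and the binomial basis -/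

/-- The univariate polynomial `φ` over `ℚ` is a closure property of the class `C` of counting
functions: `φ(f) ∈ C` for all `f ∈ C`. -/
def IsClosureProperty (C : Set (List Bool → ℕ)) (φ : ℚ[X]) : Prop :=
  ∀ f ∈ C, ∃ g ∈ C, ∀ w, (g w : ℚ) = φ.eval (f w : ℚ)

/-- The closure property `φ` relativizes: it is a closure property of `#P^A` for all languages
`A`. -/
def Relativizes (φ : ℚ[X]) : Prop :=
  ∀ A : Set (List Bool), IsClosureProperty (SharpPRel A) φ

/-- The univariate binomial basis conjecture: the univariate polynomial closure properties of
`#P` all relativize. -/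
def UnivariateBinomialBasisConjecture : Prop :=
  ∀ φ : ℚ[X], IsClosureProperty SharpP φ → Relativizes φ

/-- The element `x (x - 1) ⋯ (x - a + 1) / a!` of the binomial basis of `ℚ[x]`. -/
def binomPoly (a : ℕ) : ℚ[X] :=
  C ((a.factorial : ℚ)⁻¹) * descPochhammer ℚ a

/-- `φ` is binomial-good: its coefficients over the binomial basis are nonnegative integers. -/
def BinomialGood (φ : ℚ[X]) : Prop :=
  ∃ c : ℕ →₀ ℕ, φ = c.sum fun a n => C (n : ℚ) * binomPoly a

/-- `φ` is binomial-bad: it is not binomial-good. -/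
def BinomialBad (φ : ℚ[X]) : Prop := ¬ BinomialGood φ

end CountingComplexity

end

/-!
Write `φ = (x - 1)(x - 2) / 2`. Both `#P = #P^NP` and `P = NP` imply that the indicator functions
of all sets in `NP` and of their complements are in `#P` (`IndicatorsInSharpP`): ask the oracle
about the input, or run a deterministic machine, with accepting and rejecting swapped for
complements. Everything else on the positive side happens inside `#P`, without oracles.

Suppose that a function `ψ : ℕ → ℕ` maps `#P` to itself. Then so does `n ↦ ∑ i < n, ψ i`
(`PreservesSharpP.sum_range`). Indeed, the accepting paths of a machine, in lexicographic order,
have positions `0, 1, …, n - 1`; the position of a path `y` is the number of accepting paths that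
are smaller, which is in `#P` as a function of the input and `y`
(`exists_mem_sharpP_predecessors`), and `#P` is closed under summation over accepting paths
(`sum_map_mem_sharpP`). If the indicator functions of sets in `NP` are in `#P`, then the sign
function maps `#P` to itself. Summing it twice gives `∑ 1 ≤ i < n, (i - 1)`, which is `φ n` for
`n ≥ 1` and `0` for `n = 0`. As `φ 0 = 1`, it remains to add the indicator function of `{f = 0}`,
the complement of a set in `NP`. So `φ` is a closure property of `#P`
(`isClosureProperty_of_indicatorsInSharpP`).

On the other hand `φ` does not relativize (`not_relativizes`). Let `f w` be the number of words of
length `|w|` in the oracle. If the oracle has no word of this length, a machine for `φ ∘ f` must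
have an accepting path, as `φ 0 = 1`. This path asks about polynomially many words only, so
another word of length `|w|` can be put into the oracle without destroying the path, although
`φ 1 = 0` (`exists_numAcc_ne`). One oracle that defeats all machines exists by the Baire category
theorem in the space of all oracles, because there are countably many machines up to renaming
and a computation on a fixed input depends on finitely many words of the oracle. Hence the
univariate binomial basis conjecture refutes both equalities. Finally, a
binomial-good polynomial is monotone on the natural numbers, but `φ 0 > φ 1`.

The machines are verified through `OracleNTM.Enumerates`, which lists the accepting paths of a
computation tree in order, and `OracleNTM.Embeds`, which says that a configuration of one machine
is shown on some tapes of another one.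
-/

noncomputable section

namespace CountingComplexity

/-! ### The computation tree of a configuration -/

namespace OracleNTM

variable {M N : OracleNTM} {A B : Set (List Bool)}

/-- `M.Enumerates A t c l`: every computation path from `c` with oracle `A` halts after at most
`t` steps, and `l` lists the choice sequences of the accepting ones from left to right. -/
inductive Enumerates (M : OracleNTM) (A : Set (List Bool)) :
    ℕ → M.Cfg → List (List Bool) → Prop
  | accept {t : ℕ} {c : M.Cfg} (h : M.step A c = .accept) : Enumerates M A t c [[]]
  | reject {t : ℕ} {c : M.Cfg} (h : M.step A c = .reject) : Enumerates M A t c []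
  | next {t : ℕ} {c c' : M.Cfg} {l : List (List Bool)} (h : M.step A c = .next c')
      (h' : Enumerates M A t c' l) : Enumerates M A (t + 1) c l
  | branch {t : ℕ} {c : M.Cfg} {d : Bool → M.Cfg} {l₀ l₁ : List (List Bool)}
      (h : M.step A c = .branch d) (h₀ : Enumerates M A t (d false) l₀)
      (h₁ : Enumerates M A t (d true) l₁) :
      Enumerates M A (t + 1) c (l₀.map (List.cons false) ++ l₁.map (List.cons true))

theorem HaltsWithin.exists_enumerates {t : ℕ} {c : M.Cfg} (h : M.HaltsWithin A t c) :
    ∃ l, M.Enumerates A t c l := by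
  induction h with
  | accept h => exact ⟨_, .accept h⟩
  | reject h => exact ⟨_, .reject h⟩
  | next h _ ih => exact ih.imp fun _ hl => .next h hl
  | branch h _ ih =>
    obtain ⟨l₀, h₀⟩ := ih false
    obtain ⟨l₁, h₁⟩ := ih true
    exact ⟨_, .branch h h₀ h₁⟩

theorem Enumerates.haltsWithin {t : ℕ} {c : M.Cfg} {l : List (List Bool)}
    (h : M.Enumerates A t c l) : M.HaltsWithin A t c := by
  induction h with
  | accept h => exact .accept h
  | reject h => exact .reject h
  | next h _ ih => exact .next h ih
  | branch h _ _ ih₀ ih₁ => exact .branch h (Bool.forall_bool.2 ⟨ih₀, ih₁⟩)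

theorem Enumerates.mono {s t : ℕ} {c : M.Cfg} {l : List (List Bool)}
    (h : M.Enumerates A s c l) (hst : s ≤ t) : M.Enumerates A t c l := by
  induction h generalizing t with
  | accept h => exact .accept h
  | reject h => exact .reject h
  | next h _ ih =>
    obtain ⟨t, rfl⟩ := Nat.exists_eq_add_of_le' (Nat.one_le_of_lt hst)
    exact .next h (ih (by omega))
  | branch h _ _ ih₀ ih₁ =>
    obtain ⟨t, rfl⟩ := Nat.exists_eq_add_of_le' (Nat.one_le_of_lt hst)
    exact .branch h (ih₀ (by omega)) (ih₁ (by omega))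

theorem Enumerates.mem_iff {t : ℕ} {c : M.Cfg} {l : List (List Bool)}
    (h : M.Enumerates A t c l) (y : List Bool) : y ∈ l ↔ M.AcceptsAlong A c y := by
  induction h generalizing y with
  | accept h =>
    refine ⟨fun hy => ?_, fun hy => ?_⟩
    · rw [List.mem_singleton.1 hy]
      exact .halt h
    · cases hy <;> simp_all
  | reject h =>
    refine ⟨fun hy => by simp at hy, fun hy => ?_⟩
    cases hy <;> simp_all
  | next h _ ih =>
    rw [ih]
    refine ⟨fun hy => .next h hy, fun hy => ?_⟩
    cases hy <;> simp_all
  | branch h _ _ ih₀ ih₁ =>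
    simp only [List.mem_append, List.mem_map, ih₀, ih₁]
    refine ⟨?_, fun hy => ?_⟩
    · rintro (⟨y, hy, rfl⟩ | ⟨y, hy, rfl⟩)
      · exact .branch h _ hy
      · exact .branch h _ hy
    · cases hy with
      | halt h' => simp_all
      | next h' => simp_all
      | branch h' b hy =>
        obtain rfl := Outcome.branch.inj (h.symm.trans h')
        cases b
        · exact .inl ⟨_, hy, rfl⟩
        · exact .inr ⟨_, hy, rfl⟩

/-- The enumeration is in lexicographic order. -/
theorem Enumerates.pairwise_lt {t : ℕ} {c : M.Cfg} {l : List (List Bool)}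
    (h : M.Enumerates A t c l) : l.Pairwise (· < ·) := by
  induction h with
  | accept h => simp
  | reject h => simp
  | next h _ ih => exact ih
  | branch h _ _ ih₀ ih₁ =>
    simp [List.pairwise_append, List.pairwise_map, List.cons_lt_cons_iff, ih₀, ih₁]

theorem Enumerates.numAcc_eq {t : ℕ} {w : List Bool} {l : List (List Bool)}
    (h : M.Enumerates A t (M.init w) l) : M.numAcc A w = l.length := by
  have hs : {y : List Bool | M.AcceptsAlong A (M.init w) y} = (l.toFinset : Set (List Bool)) := by
    ext y
    simp [h.mem_iff y]
  rw [numAcc, hs, Set.ncard_coe_finset, List.toFinset_card_of_nodup]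
  exact h.pairwise_lt.imp fun hab => ne_of_lt hab

/-- `M.Counts A t c n`: every computation path from `c` with oracle `A` halts after at most
`t` steps, and `n` of them accept. -/
def Counts (M : OracleNTM) (A : Set (List Bool)) (t : ℕ) (c : M.Cfg) (n : ℕ) : Prop :=
  ∃ l, M.Enumerates A t c l ∧ l.length = n

theorem Counts.accept {t : ℕ} {c : M.Cfg} (h : M.step A c = .accept) : M.Counts A t c 1 :=
  ⟨_, .accept h, rfl⟩

theorem Counts.reject {t : ℕ} {c : M.Cfg} (h : M.step A c = .reject) : M.Counts A t c 0 :=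
  ⟨_, .reject h, rfl⟩

theorem Counts.next {t n : ℕ} {c c' : M.Cfg} (h : M.step A c = .next c')
    (h' : M.Counts A t c' n) : M.Counts A (t + 1) c n :=
  h'.imp fun _ hl => ⟨.next h hl.1, hl.2⟩

theorem Counts.branch {t m n : ℕ} {c : M.Cfg} {d : Bool → M.Cfg} (h : M.step A c = .branch d)
    (h₀ : M.Counts A t (d false) m) (h₁ : M.Counts A t (d true) n) :
    M.Counts A (t + 1) c (m + n) := by
  obtain ⟨l₀, h₀, rfl⟩ := h₀
  obtain ⟨l₁, h₁, rfl⟩ := h₁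
  exact ⟨_, .branch h h₀ h₁, by simp⟩

theorem Counts.mono {s t n : ℕ} {c : M.Cfg} (h : M.Counts A s c n) (hst : s ≤ t) :
    M.Counts A t c n :=
  h.imp fun _ hl => ⟨hl.1.mono hst, hl.2⟩

theorem Counts.numAcc_eq {t n : ℕ} {w : List Bool} (h : M.Counts A t (M.init w) n) :
    M.numAcc A w = n := by
  obtain ⟨l, hl, rfl⟩ := h
  exact hl.numAcc_eq

theorem PolyTime.exists_counts (h : M.PolyTime) :
    ∃ p : ℕ[X], ∀ A w, M.Counts A (p.eval w.length) (M.init w) (M.numAcc A w) := by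
  obtain ⟨p, hp⟩ := h
  refine ⟨p, fun A w => ?_⟩
  obtain ⟨l, hl⟩ := (hp A w).exists_enumerates
  exact ⟨l, hl, hl.numAcc_eq.symm⟩

theorem polyTime_of_counts (p : ℕ[X])
    (h : ∀ A w, ∃ n, M.Counts A (p.eval w.length) (M.init w) n) : M.PolyTime := by
  refine ⟨p, fun A w => ?_⟩
  obtain ⟨n, l, hl, -⟩ := h A w
  exact hl.haltsWithin

end OracleNTM

/-- The time bound has to hold for all oracles, the count only for the oracle `A`. -/
theorem mem_sharpPRel_of_counts {N : OracleNTM} {A : Set (List Bool)} {f : List Bool → ℕ}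
    (p : ℕ[X]) (h : ∀ B w, ∃ n, N.Counts B (p.eval w.length) (N.init w) n ∧ (B = A → n = f w)) :
    f ∈ SharpPRel A := by
  refine ⟨N, N.polyTime_of_counts p fun B w => (h B w).imp fun _ hn => hn.1, fun w => ?_⟩
  obtain ⟨n, hn, hf⟩ := h A w
  rw [hn.numAcc_eq, hf rfl]

theorem eval_le_eval (p : ℕ[X]) {m n : ℕ} (h : m ≤ n) : p.eval m ≤ p.eval n := by
  simp only [eval_eq_sum, Polynomial.sum]
  gcongr

/-! ### Simulating one machine inside another -/

/-- An action of a machine with tapes `K` and states `Q`, performed by a machine that has the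
tapes `K` among its tapes `K'` via `ι` and runs in states `g q`. The symbols under the heads are
`s`; tapes outside the range of `ι` are left alone. Queries are answered by no, as the empty oracle
would answer them; what to do instead of accepting and of choosing is prescribed. -/
def Action.lift {K Q K' Q' : Type} (a : Action K Q) (ι : K → K') (g : Q → Q')
    (s : K' → Option Bool) (onAccept : Action K' Q') (onChoose : (Bool → Q) → Action K' Q') :
    Action K' Q' :=
  match a with
  | .accept => onAccept
  | .reject => .reject
  | .move q write shift =>
      .move (g q) (Function.extend ι write s) (Function.extend ι shift fun _ => .stay)
  | .choose r => onChoose r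
  | .query r => .move (g (r false)) s fun _ => .stay

namespace OracleNTM

variable {M N : OracleNTM} {A : Set (List Bool)}

/-- The symbols under the heads. -/
def Cfg.read (c : M.Cfg) : M.K → Option Bool := fun k => c.tape k (c.head k)

/-- The head of tape `k` is at position `i` and the tape has contents `T`. -/
def Cfg.At (c : M.Cfg) (k : M.K) (i : ℤ) (T : Tape) : Prop := c.head k = i ∧ c.tape k = T

theorem Cfg.At.read {c : M.Cfg} {k : M.K} {i : ℤ} {T : Tape} (h : c.At k i T) :
    c.read k = T i := by
  rw [Cfg.read, h.1, h.2]

/-- The configuration `c'` of `N` shows the configuration `c` of `M` in the states `g q` and on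
the tapes `ι k`. -/
structure Embeds (ι : M.K → N.K) (g : M.Q → N.Q) (c : M.Cfg) (c' : N.Cfg) : Prop where
  state : c'.state = g c.state
  head : ∀ k, c'.head (ι k) = c.head k
  tape : ∀ k, c'.tape (ι k) = c.tape k

theorem Embeds.read {ι : M.K → N.K} {g : M.Q → N.Q} {c : M.Cfg} {c' : N.Cfg}
    (h : Embeds ι g c c') : c'.read ∘ ι = c.read := by
  funext k
  simp [Cfg.read, h.head, h.tape]

@[simp]
theorem answer_empty (c : M.Cfg) : M.answer ∅ c = false := by
  simp [answer]

theorem step_of_accept {c : M.Cfg} (h : M.δ c.state c.read = .accept) :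
    M.step A c = .accept := by
  unfold Cfg.read at h
  simp [step, h]

theorem step_of_reject {c : M.Cfg} (h : M.δ c.state c.read = .reject) :
    M.step A c = .reject := by
  unfold Cfg.read at h
  simp [step, h]

theorem step_of_move {c : M.Cfg} {q : M.Q} {write : M.K → Option Bool} {shift : M.K → Shift}
    (h : M.δ c.state c.read = .move q write shift) :
    M.step A c = .next ⟨q, fun k => c.head k + (shift k).toInt,
      fun k => Function.update (c.tape k) (c.head k) (write k)⟩ := by
  unfold Cfg.read at h
  simp [step, h]

theorem step_of_choose {c : M.Cfg} {r : Bool → M.Q} (h : M.δ c.state c.read = .choose r) :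
    M.step A c = .branch fun b => { c with state := r b } := by
  unfold Cfg.read at h
  simp [step, h]

theorem step_of_query {c : M.Cfg} {r : Bool → M.Q} (h : M.δ c.state c.read = .query r) :
    M.step A c = .next { c with state := r (M.answer A c) } := by
  unfold Cfg.read at h
  simp [step, h]

theorem δ_of_step_eq_accept {c : M.Cfg} (h : M.step A c = .accept) :
    M.δ c.state c.read = .accept := by
  cases hM : M.δ c.state c.read with
  | accept => rfl
  | reject => simp [step_of_reject hM] at h
  | move => simp [step_of_move hM] at h
  | choose => simp [step_of_choose hM] at h
  | query => simp [step_of_query hM] at h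

theorem δ_of_step_eq_reject {c : M.Cfg} (h : M.step A c = .reject) :
    M.δ c.state c.read = .reject := by
  cases hM : M.δ c.state c.read with
  | accept => simp [step_of_accept hM] at h
  | reject => rfl
  | move => simp [step_of_move hM] at h
  | choose => simp [step_of_choose hM] at h
  | query => simp [step_of_query hM] at h

theorem δ_of_step_eq_branch {c : M.Cfg} {d : Bool → M.Cfg} (h : M.step A c = .branch d) :
    ∃ r, M.δ c.state c.read = .choose r ∧ d = fun b => { c with state := r b } := by
  cases hM : M.δ c.state c.read with
  | accept => simp [step_of_accept hM] at h
  | reject => simp [step_of_reject hM] at h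
  | move => simp [step_of_move hM] at h
  | choose r =>
    rw [step_of_choose hM] at h
    exact ⟨r, rfl, (Outcome.branch.inj h).symm⟩
  | query => simp [step_of_query hM] at h

theorem δ_of_step_eq_next {c c' : M.Cfg} (h : M.step A c = .next c') :
    (∃ q write shift, M.δ c.state c.read = .move q write shift ∧
      c' = ⟨q, fun k => c.head k + (shift k).toInt,
        fun k => Function.update (c.tape k) (c.head k) (write k)⟩) ∨
    ∃ r, M.δ c.state c.read = .query r ∧ c' = { c with state := r (M.answer A c) } := by
  cases hM : M.δ c.state c.read with
  | accept => simp [step_of_accept hM] at h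
  | reject => simp [step_of_reject hM] at h
  | move q write shift =>
    rw [step_of_move hM] at h
    exact .inl ⟨q, write, shift, rfl, (Outcome.next.inj h).symm⟩
  | choose r => simp [step_of_choose hM] at h
  | query r =>
    rw [step_of_query hM] at h
    exact .inr ⟨r, rfl, (Outcome.next.inj h).symm⟩

section Lift

variable {ι : M.K → N.K} {g : M.Q → N.Q} {c : M.Cfg} {c' : N.Cfg} {onAccept : Action N.K N.Q}
  {onChoose : (Bool → M.Q) → Action N.K N.Q}

/-- A deterministic step of the simulated machine is simulated by one step. -/
theorem Embeds.exists_next (hι : ι.Injective) (he : Embeds ι g c c')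
    (hδ : N.δ c'.state c'.read = (M.δ c.state c.read).lift ι g c'.read onAccept onChoose)
    {d : M.Cfg} (h : M.step ∅ c = .next d) :
    ∃ d', N.step A c' = .next d' ∧ Embeds ι g d d' ∧
      ∀ k, (¬ ∃ j, ι j = k) → d'.At k (c'.head k) (c'.tape k) := by
  obtain ⟨q, write, shift, hM, rfl⟩ | ⟨r, hM, rfl⟩ := δ_of_step_eq_next h
  · rw [hM] at hδ
    refine ⟨_, step_of_move hδ, ⟨rfl, fun k => ?_, fun k => ?_⟩, fun k hk => ⟨?_, ?_⟩⟩
    · simp [hι.extend_apply, he.head]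
    · simp [hι.extend_apply, he.head, he.tape]
    · simp [Function.extend_apply' _ _ _ hk, Shift.toInt]
    · simp [Function.extend_apply' _ _ _ hk, Cfg.read]
  · rw [hM] at hδ
    refine ⟨_, step_of_move hδ, ⟨by simp, fun k => ?_, fun k => ?_⟩, fun k hk => ⟨?_, ?_⟩⟩
    · simp [he.head, Shift.toInt]
    · simp [Cfg.read, he.tape]
    · simp [Shift.toInt]
    · simp [Cfg.read]

/-- A machine that does nothing but simulate another one has the same computation tree. -/
theorem Embeds.counts (hι : ι.Injective)
    (hδ : ∀ q s, N.δ (g q) s = (M.δ q (s ∘ ι)).lift ι g s .accept fun r => .choose (g ∘ r))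
    (he : Embeds ι g c c') {t n : ℕ} (h : M.Counts ∅ t c n) : N.Counts A t c' n := by
  obtain ⟨l, h, rfl⟩ := h
  have hδ' : ∀ {c : M.Cfg} {c' : N.Cfg}, Embeds ι g c c' → N.δ c'.state c'.read =
      (M.δ c.state c.read).lift ι g c'.read .accept fun r => .choose (g ∘ r) := by
    intro c c' he
    rw [he.state, hδ, he.read]
  induction h generalizing c' with
  | accept h =>
    refine .accept (step_of_accept ?_)
    rw [hδ' he, δ_of_step_eq_accept h, Action.lift]
  | reject h =>
    refine .reject (step_of_reject ?_)
    rw [hδ' he, δ_of_step_eq_reject h, Action.lift]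
  | next h _ ih =>
    obtain ⟨d', hd', he', -⟩ := he.exists_next hι (hδ' he) h (A := A)
    exact .next hd' (ih he')
  | branch h _ _ ih₀ ih₁ =>
    obtain ⟨r, hr, rfl⟩ := δ_of_step_eq_branch h
    have hc := hδ' he
    rw [hr, Action.lift] at hc
    have := Counts.branch (step_of_choose (A := A) hc) (ih₀ ⟨rfl, he.head, he.tape⟩)
      (ih₁ ⟨rfl, he.head, he.tape⟩)
    simpa using this

end Lift

end OracleNTM

/-! ### Words on tapes -/

theorem Tape.ofWord_append_length (u v : List Bool) :
    Tape.ofWord (u ++ v) (u.length : ℤ) = v.head? := by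
  cases v <;> simp [Tape.ofWord]

theorem Tape.update_ofWord (u : List Bool) (b : Bool) :
    Function.update (Tape.ofWord u) (u.length : ℤ) (some b) = Tape.ofWord (u ++ [b]) := by
  funext i
  rcases i with n | n
  · by_cases h : n = u.length
    · subst h
      simp [Tape.ofWord]
    · have h' : (Int.ofNat n) ≠ (u.length : ℤ) := by simpa using h
      rw [Function.update_of_ne h']
      simp only [Tape.ofWord, List.getElem?_append]
      split_ifs with h2
      · rfl
      · rw [List.getElem?_eq_none (by omega), List.getElem?_eq_none (by simp; omega)]
  · rw [Function.update_of_ne (by simp)]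
    rfl

theorem Tape.Holds.unique {t : Tape} {y y' : List Bool} (h : t.Holds y) (h' : t.Holds y') :
    y = y' := by
  wlog hle : y.length ≤ y'.length generalizing y y'
  · exact (this h' h (le_of_not_ge hle)).symm
  have hlen : y'.length ≤ y.length := by simpa using (h' _ hle).symm.trans (h _ le_rfl)
  refine List.ext_getElem? fun i => ?_
  rcases le_or_gt i y.length with hi | hi
  · exact (h i hi).symm.trans (h' i (hi.trans hle))
  · rw [List.getElem?_eq_none (by omega), List.getElem?_eq_none (by omega)]

theorem Tape.holds_ofWord (w y : List Bool) : (Tape.ofWord w).Holds y ↔ y = w := by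
  have hw : (Tape.ofWord w).Holds w := fun _ _ => rfl
  exact ⟨fun h => h.unique hw, fun h => h ▸ hw⟩

/-! ### Moving two heads -/

open Classical in
/-- Move the head of tape `a`, and go to state `q`; the symbols under the heads are `s`. -/
def Action.shift {K Q : Type} (s : K → Option Bool) (a : K) (d : Shift) (q : Q) : Action K Q :=
  .move q s (Function.update (fun _ => .stay) a d)

open Classical in
/-- Write `x` on tape `b` and move its head by `e`, move the head of tape `a` by `d`, and go to
state `q`; the symbols under the heads are `s`. -/
def Action.write {K Q : Type} (s : K → Option Bool) (b : K) (x : Option Bool) (e : Shift)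
    (a : K) (d : Shift) (q : Q) : Action K Q :=
  .move q (Function.update s b x) (Function.update (Function.update (fun _ => .stay) a d) b e)

namespace OracleNTM

variable {M N : OracleNTM} {A : Set (List Bool)}

theorem Counts.shift {c : N.Cfg} {a : N.K} {d : Shift} {q : N.Q}
    (h : N.δ c.state c.read = .shift c.read a d q) {t n : ℕ}
    (h' : ∀ c' : N.Cfg, c'.state = q → c'.At a (c.head a + d.toInt) (c.tape a) →
      (∀ k, k ≠ a → c'.At k (c.head k) (c.tape k)) → N.Counts A t c' n) :
    N.Counts A (t + 1) c n := by
  refine .next (step_of_move h) (h' _ rfl ⟨?_, ?_⟩ fun k hk => ⟨?_, ?_⟩)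
  · simp
  · simp [Cfg.read]
  · simp [hk, Shift.toInt]
  · simp [Cfg.read]

theorem Counts.write {c : N.Cfg} {a b : N.K} (hab : a ≠ b) {x : Option Bool} {d e : Shift}
    {q : N.Q} (h : N.δ c.state c.read = .write c.read b x e a d q) {t n : ℕ}
    (h' : ∀ c' : N.Cfg, c'.state = q → c'.At a (c.head a + d.toInt) (c.tape a) →
      c'.At b (c.head b + e.toInt) (Function.update (c.tape b) (c.head b) x) →
      (∀ k, k ≠ a → k ≠ b → c'.At k (c.head k) (c.tape k)) → N.Counts A t c' n) :
    N.Counts A (t + 1) c n := by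
  refine .next (step_of_move h) (h' _ rfl ⟨?_, ?_⟩ ⟨?_, ?_⟩ fun k hk hk' => ⟨?_, ?_⟩)
  · simp [hab]
  · simp [hab, Cfg.read]
  · simp
  · simp
  · simp [hk, hk', Shift.toInt]
  · simp [hk', Cfg.read]

/-- A head that runs to the left over a word up to the first blank cell and then steps right. -/
theorem Counts.rewind {a : N.K} {back q : N.Q}
    (hδ : ∀ s, N.δ back s =
      match s a with
      | some _ => .shift s a .left back
      | none => .shift s a .right q) {t n i : ℕ} {u : List Bool} (hi : i ≤ u.length)
    {c : N.Cfg} (hc : c.state = back) (ha : c.At a ((i : ℤ) - 1) (.ofWord u))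
    (h : ∀ c' : N.Cfg, c'.state = q → c'.At a 0 (.ofWord u) →
      (∀ k, k ≠ a → c'.At k (c.head k) (c.tape k)) → N.Counts A t c' n) :
    N.Counts A (t + i + 1) c n := by
  induction i generalizing c with
  | zero =>
    have hr : N.δ c.state c.read = .shift c.read a .right q := by
      rw [hc, hδ, ha.read]
      rfl
    refine .shift hr fun c' hq ha' hk => h c' hq ?_ hk
    rwa [ha.1, ha.2] at ha'
  | succ i ih =>
    have hr : N.δ c.state c.read = .shift c.read a .left back := by
      have hi' : ((i + 1 : ℕ) : ℤ) - 1 = Int.ofNat i := by simp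
      rw [hc, hδ, ha.read, hi', Tape.ofWord, List.getElem?_eq_getElem (by omega)]
    refine .shift hr fun c' hq ha' hk => ih (by omega) hq ?_ fun c'' hq' ha₂ hk' =>
      h c'' hq' ha₂ fun k hka => ?_
    · rw [ha.1, ha.2] at ha'
      simpa [Shift.toInt, sub_eq_add_neg] using ha'
    · exact ⟨(hk' k hka).1.trans (hk k hka).1, (hk' k hka).2.trans (hk k hka).2⟩

theorem init_at_inputTape (w : List Bool) : (M.init w).At M.inputTape 0 (.ofWord w) :=
  ⟨rfl, if_pos rfl⟩

theorem init_at_of_ne (w : List Bool) {k : M.K} (hk : k ≠ M.inputTape) :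
    (M.init w).At k 0 (.ofWord []) :=
  ⟨rfl, if_neg hk⟩

/-- An initial configuration of `M` is shown by every configuration that has the input on the
right tape, blanks on the other tapes, and all heads in cell `0`. -/
theorem Embeds.of_init {ι : M.K → N.K} {g : M.Q → N.Q} {w : List Bool} {c : N.Cfg}
    (hq : c.state = g M.start) (hi : c.At (ι M.inputTape) 0 (.ofWord w))
    (hk : ∀ k, k ≠ M.inputTape → c.At (ι k) 0 (.ofWord [])) : Embeds ι g (M.init w) c := by
  refine ⟨hq, fun k => ?_, fun k => ?_⟩ <;> by_cases h : k = M.inputTape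
  · rw [h, hi.1, (init_at_inputTape w).1]
  · rw [(hk k h).1, (init_at_of_ne w h).1]
  · rw [h, hi.2, (init_at_inputTape w).2]
  · rw [(hk k h).2, (init_at_of_ne w h).2]

/-! ### Sums -/

open Classical in
/-- The tapes of `N` in the machine that runs `M` or `N`: the input tape is that of `M`. -/
def eitherTape (M N : OracleNTM) (k : N.K) : M.K ⊕ N.K :=
  if k = N.inputTape then .inl M.inputTape else .inr k

theorem eitherTape_inputTape : eitherTape M N N.inputTape = .inl M.inputTape := if_pos rfl

theorem eitherTape_of_ne {k : N.K} (hk : k ≠ N.inputTape) : eitherTape M N k = .inr k := if_neg hk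

theorem eitherTape_injective : (eitherTape M N).Injective := by
  intro k k' h
  by_cases hk : k = N.inputTape <;> by_cases hk' : k' = N.inputTape <;>
    simp_all [eitherTape]

/-- The machine that chooses to run `M` or to run `N`. The machines share the input tape. -/
def either (M N : OracleNTM) : OracleNTM where
  K := M.K ⊕ N.K
  Q := Option (M.Q ⊕ N.Q)
  finiteK := have := M.finiteK; have := N.finiteK; inferInstance
  finiteQ := have := M.finiteQ; have := N.finiteQ; inferInstance
  inputTape := .inl M.inputTape
  queryTape := .inl M.inputTape
  start := none
  δ
    | none, _ => .choose fun b => some (if b then .inr N.start else .inl M.start)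
    | some (.inl q), s => (M.δ q (s ∘ .inl)).lift .inl (some ∘ .inl) s .accept
        fun r => .choose (some ∘ .inl ∘ r)
    | some (.inr q), s =>
        (N.δ q (s ∘ eitherTape M N)).lift (eitherTape M N) (some ∘ .inr) s .accept
          fun r => .choose (some ∘ .inr ∘ r)

end OracleNTM

open OracleNTM in
theorem add_mem_sharpP {f g : List Bool → ℕ} (hf : f ∈ SharpP) (hg : g ∈ SharpP) :
    (fun w => f w + g w) ∈ SharpP := by
  obtain ⟨M, hM, hf⟩ := hf
  obtain ⟨N, hN, hg⟩ := hg
  obtain ⟨p, hp⟩ := hM.exists_counts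
  obtain ⟨q, hq⟩ := hN.exists_counts
  refine mem_sharpPRel_of_counts (N := M.either N) (p + q + 1) fun B w =>
    ⟨f w + g w, ?_, fun _ => rfl⟩
  have h₀ := (hp ∅ w).mono (Nat.le_add_right _ (q.eval w.length))
  have h₁ := (hq ∅ w).mono (Nat.le_add_left _ (p.eval w.length))
  rw [← hf] at h₀
  rw [← hg] at h₁
  simp only [eval_add, eval_one]
  refine .branch (step_of_choose rfl) ?_ ?_
  · exact Embeds.counts (M := M) (N := M.either N) (ι := .inl) (g := some ∘ .inl)
      Sum.inl_injective (fun _ _ => rfl) (.of_init rfl ⟨rfl, if_pos rfl⟩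
        fun k hk => ⟨rfl, if_neg (Sum.inl_injective.ne hk)⟩) h₀
  · exact Embeds.counts (M := N) (N := M.either N) (ι := eitherTape M N) (g := some ∘ .inr)
      eitherTape_injective (fun _ _ => rfl) (.of_init rfl ⟨rfl, if_pos eitherTape_inputTape⟩
        fun k hk => ⟨rfl, if_neg ((eitherTape_of_ne hk).trans_ne Sum.inr_ne_inl)⟩) h₁

/-! ### Words that encode an input and a path -/

/-- The word that encodes the pair `(w, y)`: every bit of `w` follows a tag `0`, and a tag `1`
announces `y`. -/
def encode (w y : List Bool) : List Bool :=
  w.flatMap (fun b => [false, b]) ++ true :: y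

theorem encode_append (w y z : List Bool) : encode w (y ++ z) = encode w y ++ z := by
  simp [encode]

theorem length_encode (w y : List Bool) : (encode w y).length = 2 * w.length + 1 + y.length := by
  induction w with
  | nil => simp [encode]; omega
  | cons b w ih => simp_all [encode]; omega

@[simp]
theorem encode_nil (y : List Bool) : encode [] y = true :: y := rfl

@[simp]
theorem encode_cons (b : Bool) (w y : List Bool) :
    encode (b :: w) y = false :: b :: encode w y := rfl

/-- The value of `g` at the pair that `v` encodes, where `u` was decoded before; it is `0` if `v`
does not encode a pair. -/
def decodeWith (g : List Bool → List Bool → ℕ) : List Bool → List Bool → ℕ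
  | u, true :: y => g u y
  | u, false :: b :: v => decodeWith g (u ++ [b]) v
  | _, _ => 0

theorem decodeWith_encode (g : List Bool → List Bool → ℕ) (u w y : List Bool) :
    decodeWith g u (encode w y) = g (u ++ w) y := by
  induction w generalizing u with
  | nil => simp [decodeWith]
  | cons b w ih => simp [decodeWith, ih]

namespace OracleNTM

variable {M V : OracleNTM} {A : Set (List Bool)}

theorem Cfg.At.congr {N : OracleNTM} {c c' : N.Cfg} {k : N.K} {i : ℤ} {T : Tape}
    (h' : c'.At k (c.head k) (c.tape k)) (h : c.At k i T) : c'.At k i T :=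
  ⟨h'.1.trans h.1, h'.2.trans h.2⟩

/-! ### Counting the accepting paths to the left of a given path -/

/-- The states of the machine `predecessors M`. -/
inductive PredState (Q : Type)
  /-- read the tag of the next bit of the encoded pair -/
  | tag
  /-- copy the next bit to the input tape of `M` -/
  | bit
  /-- return to the beginning of the input tape of `M` -/
  | back
  /-- run `M` on a path that agrees with `y` so far -/
  | follow (q : Q)
  /-- step over a bit of `y` -/
  | advance (q : Q)
  /-- run `M` on a path that has left `y` to the left -/
  | free (q : Q)

instance (Q : Type) [Finite Q] : Finite (PredState Q) :=
  .of_surjective (α := Fin 3 ⊕ Q ⊕ Q ⊕ Q)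
    (fun
      | .inl 0 => .tag
      | .inl 1 => .bit
      | .inl 2 => .back
      | .inr (.inl q) => .follow q
      | .inr (.inr (.inl q)) => .advance q
      | .inr (.inr (.inr q)) => .free q)
    (by
      rintro (_ | _ | _ | q | q | q)
      exacts [⟨.inl 0, rfl⟩, ⟨.inl 1, rfl⟩, ⟨.inl 2, rfl⟩, ⟨.inr (.inl q), rfl⟩,
        ⟨.inr (.inr (.inl q)), rfl⟩, ⟨.inr (.inr (.inr q)), rfl⟩])

/-- When the path followed ends, it is to the left of `y` if it is a proper prefix of `y`. -/
def followAccept (M : OracleNTM) (s : M.K ⊕ Unit → Option Bool) :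
    Action (M.K ⊕ Unit) (PredState M.Q) :=
  match s (.inr ()) with
  | some _ => .accept
  | none => .reject

/-- At a choice, the path followed goes on along `y` or, if `y` turns right, leaves `y` to the
left. -/
def followChoose (M : OracleNTM) (s : M.K ⊕ Unit → Option Bool) (r : Bool → M.Q) :
    Action (M.K ⊕ Unit) (PredState M.Q) :=
  match s (.inr ()) with
  | some true => .choose fun b => if b then .advance (r true) else .free (r false)
  | some false => .shift s (.inr ()) .right (.follow (r false))
  | none => .reject

/-- The machine that, on the input `encode w y`, has the accepting paths of `M` on input `w` that
are lexicographically smaller than `y`. It decodes `w` to the input tape of `M`, leaving its head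
at the beginning of `y`. Then it runs `M`, following `y` until it takes a left turn where `y` takes
a right turn. -/
def predecessors (M : OracleNTM) : OracleNTM where
  K := M.K ⊕ Unit
  Q := PredState M.Q
  finiteK := have := M.finiteK; inferInstance
  finiteQ := have := M.finiteQ; inferInstance
  inputTape := .inr ()
  queryTape := .inr ()
  start := .tag
  δ
    | .tag, s =>
      match s (.inr ()) with
      | some false => .shift s (.inr ()) .right .bit
      | some true => .write s (.inr ()) (some true) .right (.inl M.inputTape) .left .back
      | none => .reject
    | .bit, s =>
      match s (.inr ()) with
      | some b => .write s (.inl M.inputTape) (some b) .right (.inr ()) .right .tag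
      | none => .reject
    | .back, s =>
      match s (.inl M.inputTape) with
      | some _ => .shift s (.inl M.inputTape) .left .back
      | none => .shift s (.inl M.inputTape) .right (.follow M.start)
    | .follow q, s => (M.δ q (s ∘ .inl)).lift .inl .follow s (followAccept M s) (followChoose M s)
    | .advance q, s => .shift s (.inr ()) .right (.follow q)
    | .free q, s => (M.δ q (s ∘ .inl)).lift .inl .free s .accept fun r => .choose (.free ∘ r)

/-- From the configuration in which `w` is decoded, the paths that follow `M` along `y` correspond
to the accepting paths of `M` below `y`. -/
theorem counts_predecessors_follow {t : ℕ} {c : M.Cfg} {l : List (List Bool)}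
    (h : M.Enumerates ∅ t c l) {u y : List Bool} {c' : (predecessors M).Cfg}
    (he : Embeds (N := predecessors M) .inl .follow c c')
    (hy : c'.At (.inr ()) u.length (.ofWord (u ++ y))) :
    (predecessors M).Counts A (2 * t) c' (l.filter (· < y)).length := by
  have hδ : ∀ {c : M.Cfg} {c' : (predecessors M).Cfg},
      Embeds (N := predecessors M) .inl .follow c c' →
      (predecessors M).δ c'.state c'.read = (M.δ c.state c.read).lift .inl .follow c'.read
        (followAccept M c'.read) (followChoose M c'.read) := by
    intro c c' he
    rw [he.state, ← he.read]
    rfl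
  have hread : ∀ {u y : List Bool} {c' : (predecessors M).Cfg},
      c'.At (.inr ()) u.length (.ofWord (u ++ y)) → c'.read (.inr ()) = y.head? := by
    intro u y c' hy
    rw [hy.read, Tape.ofWord_append_length]
  induction h generalizing u y c' with
  | accept h =>
    have h1 : (predecessors M).δ c'.state c'.read = match y.head? with
        | some _ => .accept
        | none => .reject := by
      rw [hδ he, δ_of_step_eq_accept h, ← hread hy]
      rfl
    cases y with
    | nil => exact .reject (step_of_reject h1)
    | cons b y => exact .accept (step_of_accept h1)
  | reject h =>
    refine .reject (step_of_reject ?_)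
    rw [hδ he, δ_of_step_eq_reject h]
    rfl
  | next h _ ih =>
    obtain ⟨d', hd', he', hk⟩ := he.exists_next Sum.inl_injective (hδ he) h (A := A)
    exact (Counts.next hd' (ih he' ((hk _ (by simp)).congr hy))).mono (by omega)
  | @branch t c d l₀ l₁ h h₀ _ ih₀ ih₁ =>
    obtain ⟨r, hr, rfl⟩ := δ_of_step_eq_branch h
    have h1 : (predecessors M).δ c'.state c'.read = match y.head? with
        | some true => .choose fun b => if b then .advance (r true) else .free (r false)
        | some false => .shift c'.read (.inr ()) .right (.follow (r false))
        | none => .reject := by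
      rw [hδ he, hr, ← hread hy]
      rfl
    have hstep : ∀ (b : Bool) {c₁ c₂ : (predecessors M).Cfg} (z : List Bool),
        c₁.At (.inr ()) u.length (.ofWord (u ++ b :: z)) →
        c₂.At (.inr ()) (c₁.head (.inr ()) + Shift.right.toInt) (c₁.tape (.inr ())) →
        c₂.At (.inr ()) (u ++ [b]).length (.ofWord ((u ++ [b]) ++ z)) := by
      intro b c₁ c₂ z hc₁ hc₂
      rw [hc₁.1, hc₁.2] at hc₂
      simpa [Shift.toInt] using hc₂
    match y, hy, h1 with
    | [], _, h1 =>
      have : (l₀.map (List.cons false) ++ l₁.map (List.cons true)).filter (· < []) = [] := by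
        simp
      rw [this]
      exact .reject (step_of_reject h1)
    | false :: y, hy, h1 =>
      have : ((l₀.map (List.cons false) ++ l₁.map (List.cons true)).filter
          (· < false :: y)).length = (l₀.filter (· < y)).length := by
        simp [List.filter_map, Function.comp_def, List.cons_lt_cons_iff]
      rw [this]
      refine Counts.mono (.shift h1 fun c'' hq hi hk =>
        ih₀ (u := u ++ [false]) ⟨hq, fun k => ?_, fun k => ?_⟩ (hstep false y hy hi)) (by omega)
      · rw [(hk _ Sum.inl_ne_inr).1, he.head]
      · rw [(hk _ Sum.inl_ne_inr).2, he.tape]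
    | true :: y, hy, h1 =>
      have : ((l₀.map (List.cons false) ++ l₁.map (List.cons true)).filter
          (· < true :: y)).length = l₀.length + (l₁.filter (· < y)).length := by
        simp [List.filter_map, Function.comp_def, List.cons_lt_cons_iff]
      rw [this]
      refine .branch (t := 2 * t + 1) (step_of_choose h1) ?_ ?_
      · have he' : Embeds (M := M) (N := predecessors M) .inl .free { c with state := r false }
            { c' with state := .free (r false) } := ⟨rfl, he.head, he.tape⟩
        exact (he'.counts Sum.inl_injective (fun _ _ => rfl) ⟨l₀, h₀, rfl⟩).mono (by omega)
      · refine Counts.shift (N := predecessors M) (q := PredState.follow (r true)) rfl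
          fun c'' hq hi hk =>
            ih₁ (u := u ++ [true]) ⟨hq, fun k => ?_, fun k => ?_⟩ (hstep true y hy hi)
        · rw [(hk _ Sum.inl_ne_inr).1]
          exact he.head k
        · rw [(hk _ Sum.inl_ne_inr).2]
          exact he.tape k

/-- The decoding: the input is `z ++ v`, of which `z` has been read and decoded to `u`. -/
theorem counts_predecessors_tag {L T : ℕ} {g : List Bool → List Bool → ℕ}
    (hg : ∀ (w y : List Bool) (c : (predecessors M).Cfg), w.length ≤ L →
      Embeds (N := predecessors M) .inl .follow (M.init w) c →
      (∃ u : List Bool, c.At (.inr ()) u.length (.ofWord (u ++ y))) →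
      (predecessors M).Counts A T c (g w y)) :
    ∀ (v u z : List Bool) (c : (predecessors M).Cfg), c.state = .tag →
      c.At (.inl M.inputTape) u.length (.ofWord u) →
      (∀ k, k ≠ M.inputTape → c.At (.inl k) 0 (.ofWord [])) →
      c.At (.inr ()) z.length (.ofWord (z ++ v)) → u.length + v.length ≤ L →
      (predecessors M).Counts A (T + L + 2 * v.length + 2) c (decodeWith g u v) := by
  have hne : (Sum.inl M.inputTape : M.K ⊕ Unit) ≠ .inr () := Sum.inl_ne_inr
  have htag : ∀ (v z : List Bool) (c : (predecessors M).Cfg), c.state = .tag →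
      c.At (.inr ()) z.length (.ofWord (z ++ v)) →
      (predecessors M).δ c.state c.read = match v.head? with
      | some false => .shift c.read (.inr ()) .right .bit
      | some true => .write c.read (.inr ()) (some true) .right (.inl M.inputTape) .left .back
      | none => .reject := by
    intro v z c hq hb
    rw [hq, ← Tape.ofWord_append_length, ← hb.read]
    rfl
  have hbit : ∀ (v z : List Bool) (c : (predecessors M).Cfg), c.state = .bit →
      c.At (.inr ()) z.length (.ofWord (z ++ v)) →
      (predecessors M).δ c.state c.read = match v.head? with
      | some b => .write c.read (.inl M.inputTape) (some b) .right (.inr ()) .right .tag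
      | none => .reject := by
    intro v z c hq hb
    rw [hq, ← Tape.ofWord_append_length, ← hb.read]
    rfl
  have hright : ∀ (z v : List Bool) (b : Bool) (c c' : (predecessors M).Cfg),
      c.At (.inr ()) z.length (.ofWord (z ++ b :: v)) →
      c'.At (.inr ()) (c.head (.inr ()) + Shift.right.toInt) (c.tape (.inr ())) →
      c'.At (.inr ()) (z ++ [b]).length (.ofWord ((z ++ [b]) ++ v)) := by
    intro z v b c c' hc hc'
    rw [hc.1, hc.2] at hc'
    simpa [Shift.toInt] using hc'
  intro v u
  induction u, v using decodeWith.induct with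
  | case1 u y =>
    intro z c hq ha hk hb hL
    simp only [List.length_cons] at hL
    refine Counts.mono (s := T + u.length + 1 + 1) (.write hne (htag _ _ _ hq hb)
      fun c' hq' ha' hb' hk' => .rewind (a := Sum.inl M.inputTape) (back := PredState.back)
        (q := PredState.follow M.start) (fun _ => rfl) (u := u) le_rfl hq' ?_
        fun c'' hq'' ha'' hk'' =>
        hg u y c'' (by omega) (.of_init hq'' ha'' fun k hki => ?_) ⟨z ++ [true], ?_⟩)
      (by simp; omega)
    · rw [ha.1, ha.2] at ha'
      exact ha'
    · have hki' : (Sum.inl k : M.K ⊕ Unit) ≠ .inl M.inputTape := Sum.inl_injective.ne hki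
      exact (hk'' _ hki').congr ((hk' _ hki' Sum.inl_ne_inr).congr (hk k hki))
    · refine (hk'' _ hne.symm).congr (hright z y true c c' hb ?_)
      rwa [hb.1, hb.2, Function.update_eq_self_iff.2, ← hb.1, ← hb.2] at hb'
      rw [Tape.ofWord_append_length]
      rfl
  | case2 u b v ih =>
    intro z c hq ha hk hb hL
    simp only [List.length_cons] at hL
    refine Counts.mono (s := T + L + 2 * v.length + 2 + 1 + 1) (.shift (htag _ _ _ hq hb)
      fun c' hq' hb' hk' => ?_) (by simp; omega)
    have hb₁ := hright z (b :: v) false c c' hb hb'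
    have ha₁ := (hk' _ hne).congr ha
    refine .write hne.symm (hbit _ _ _ hq' hb₁) fun c'' hq'' hb'' ha'' hk'' =>
      ih (z ++ [false] ++ [b]) c'' hq'' ?_ (fun k hki => ?_) (hright _ v b c' c'' hb₁ hb'')
        (by simp; omega)
    · rw [ha₁.1, ha₁.2, Tape.update_ofWord] at ha''
      simpa [Shift.toInt] using ha''
    · exact (hk'' _ Sum.inl_ne_inr fun h => hki (Sum.inl_injective h)).congr
        ((hk' _ Sum.inl_ne_inr).congr (hk k hki))
  | case3 v u h₁ h₂ =>
    intro z c hq ha hk hb hL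
    rw [decodeWith.eq_3 _ _ _ h₁ h₂]
    match v, hb with
    | [], hb => exact .reject (step_of_reject (htag _ _ _ hq hb))
    | [false], hb =>
      exact Counts.mono (s := 0 + 1) (.shift (htag _ _ _ hq hb) fun c' hq' hb' _ =>
        .reject (step_of_reject (hbit [] _ _ hq' (hright z [] false c c' hb hb')))) (by omega)
    | true :: y, _ => exact (h₁ y rfl).elim
    | false :: b :: v, _ => exact (h₂ b v rfl).elim

end OracleNTM

open OracleNTM in
/-- The position of an accepting path among all of them is a function in `#P` of the input and
the path. -/
theorem exists_mem_sharpP_predecessors {M : OracleNTM} {p : ℕ[X]}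
    {l : List Bool → List (List Bool)}
    (hl : ∀ w, M.Enumerates ∅ (p.eval w.length) (M.init w) (l w)) :
    ∃ h ∈ SharpP, ∀ w y, h (encode w y) = ((l w).filter (· < y)).length := by
  refine ⟨decodeWith (fun w y => ((l w).filter (· < y)).length) [],
    mem_sharpPRel_of_counts (N := predecessors M) (2 * p + 3 * X + 2) fun B v =>
    ⟨_, ?_, fun _ => rfl⟩, fun w y => by simp [decodeWith_encode]⟩
  refine Counts.mono (counts_predecessors_tag (L := v.length) (T := 2 * p.eval v.length)
    (fun w y c hw he hu => ?_) v [] [] _ rfl ⟨rfl, if_neg Sum.inl_ne_inr⟩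
    (fun k _ => ⟨rfl, if_neg Sum.inl_ne_inr⟩) ⟨rfl, if_pos rfl⟩ (by simp)) ?_
  · obtain ⟨u, hu⟩ := hu
    exact (counts_predecessors_follow (hl w) he hu).mono (by gcongr; exact eval_le_eval p hw)
  · simp
    omega

namespace OracleNTM

variable {M V : OracleNTM} {A : Set (List Bool)}

/-! ### Summing over the accepting paths -/

/-- The states of the machine `guess M V`. -/
inductive GuessState (Q Q' : Type)
  /-- write the tag for the next bit of the input -/
  | tag
  /-- copy the next bit of the input -/
  | bit
  /-- return to the beginning of the input -/
  | back
  /-- run `M` -/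
  | run (q : Q)
  /-- write down the choice `b` -/
  | record (q : Q) (b : Bool)
  /-- return to the beginning of the input tape of `V` -/
  | rewind
  /-- run `V` -/
  | verify (q : Q')

instance (Q Q' : Type) [Finite Q] [Finite Q'] : Finite (GuessState Q Q') :=
  .of_surjective (α := Fin 4 ⊕ Q ⊕ (Q × Bool) ⊕ Q')
    (fun
      | .inl 0 => .tag
      | .inl 1 => .bit
      | .inl 2 => .back
      | .inl 3 => .rewind
      | .inr (.inl q) => .run q
      | .inr (.inr (.inl q)) => .record q.1 q.2
      | .inr (.inr (.inr q)) => .verify q)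
    (by
      rintro (_ | _ | _ | q | ⟨q, b⟩ | _ | q)
      exacts [⟨.inl 0, rfl⟩, ⟨.inl 1, rfl⟩, ⟨.inl 2, rfl⟩, ⟨.inr (.inl q), rfl⟩,
        ⟨.inr (.inr (.inl (q, b))), rfl⟩, ⟨.inl 3, rfl⟩, ⟨.inr (.inr (.inr q)), rfl⟩])

/-- The machine that, on input `w`, guesses an accepting path `y` of `M` on input `w` and then runs
`V` on `encode w y`. The word `encode w y` is written to the input tape of `V`: the part that
depends on `w` before running `M`, and the bits of `y` whenever `M` makes a choice. -/
def guess (M V : OracleNTM) : OracleNTM where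
  K := M.K ⊕ V.K
  Q := GuessState M.Q V.Q
  finiteK := have := M.finiteK; have := V.finiteK; inferInstance
  finiteQ := have := M.finiteQ; have := V.finiteQ; inferInstance
  inputTape := .inl M.inputTape
  queryTape := .inl M.inputTape
  start := .tag
  δ
    | .tag, s =>
      match s (.inl M.inputTape) with
      | some _ => .write s (.inr V.inputTape) (some false) .right (.inl M.inputTape) .stay .bit
      | none => .write s (.inr V.inputTape) (some true) .right (.inl M.inputTape) .left .back
    | .bit, s =>
      .write s (.inr V.inputTape) (s (.inl M.inputTape)) .right (.inl M.inputTape) .right .tag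
    | .back, s =>
      match s (.inl M.inputTape) with
      | some _ => .shift s (.inl M.inputTape) .left .back
      | none => .shift s (.inl M.inputTape) .right (.run M.start)
    | .run q, s => (M.δ q (s ∘ .inl)).lift .inl .run s (.shift s (.inr V.inputTape) .left .rewind)
        fun r => .choose fun b => .record (r b) b
    | .record q b, s =>
      .write s (.inr V.inputTape) (some b) .right (.inl M.inputTape) .stay (.run q)
    | .rewind, s =>
      match s (.inr V.inputTape) with
      | some _ => .shift s (.inr V.inputTape) .left .rewind
      | none => .shift s (.inr V.inputTape) .right (.verify V.start)
    | .verify q, s => (V.δ q (s ∘ .inr)).lift .inr .verify s .accept fun r => .choose (.verify ∘ r)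

theorem Cfg.At.snoc {N : OracleNTM} {c c' : N.Cfg} {k : N.K} {u : List Bool} {b : Bool}
    (h : c.At k u.length (.ofWord u))
    (h' : c'.At k (c.head k + Shift.right.toInt)
      (Function.update (c.tape k) (c.head k) (some b))) :
    c'.At k (u ++ [b]).length (.ofWord (u ++ [b])) := by
  rw [h.1, h.2, Tape.update_ofWord] at h'
  simpa [Shift.toInt] using h'

theorem Cfg.At.stay {N : OracleNTM} {c c' : N.Cfg} {k : N.K}
    (h : c'.At k (c.head k + Shift.stay.toInt) (c.tape k)) :
    c'.At k (c.head k) (c.tape k) := by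
  simpa [Shift.toInt] using h

/-- While `M` runs, the input tape of `V` holds a word `z` that ends in the choices made so far. -/
theorem counts_guess_run {t L T : ℕ} {c : M.Cfg} {l : List (List Bool)}
    (h : M.Enumerates ∅ t c l) {g : List Bool → ℕ}
    (hg : ∀ z : List Bool, z.length ≤ L → V.Counts ∅ T (V.init z) (g z))
    {z : List Bool} {c' : (guess M V).Cfg} (he : Embeds (N := guess M V) .inl .run c c')
    (hz : c'.At (.inr V.inputTape) z.length (.ofWord z))
    (hk : ∀ k, k ≠ V.inputTape → c'.At (.inr k) 0 (.ofWord [])) (hL : z.length + t ≤ L) :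
    (guess M V).Counts A (2 * t + (T + L + 2)) c' ((l.map fun y => g (z ++ y)).sum) := by
  have hne : (Sum.inl M.inputTape : M.K ⊕ V.K) ≠ .inr V.inputTape := Sum.inl_ne_inr
  have hinr : ∀ {k}, k ≠ V.inputTape → (Sum.inr k : M.K ⊕ V.K) ≠ .inr V.inputTape :=
    fun hk h => hk (Sum.inr_injective h)
  have hδ : ∀ {c : M.Cfg} {c' : (guess M V).Cfg}, Embeds (N := guess M V) .inl .run c c' →
      (guess M V).δ c'.state c'.read = (M.δ c.state c.read).lift .inl .run c'.read
        (.shift c'.read (.inr V.inputTape) .left .rewind)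
        fun r => .choose fun b => .record (r b) b := by
    intro c c' he
    rw [he.state, ← he.read]
    rfl
  induction h generalizing z c' with
  | accept h =>
    have h1 : (guess M V).δ c'.state c'.read =
        .shift c'.read (.inr V.inputTape) .left .rewind := by
      rw [hδ he, δ_of_step_eq_accept h]
      rfl
    refine Counts.mono (s := T + z.length + 1 + 1) (.shift h1 fun c₁ hq₁ hz₁ hk₁ =>
      .rewind (a := Sum.inr V.inputTape) (back := GuessState.rewind)
        (q := GuessState.verify V.start) (fun _ => rfl) (u := z) le_rfl hq₁ ?_
        fun c₂ hq₂ hz₂ hk₂ => ?_) (by omega)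
    · rw [hz.1, hz.2] at hz₁
      exact hz₁
    · have he₂ : Embeds (N := guess M V) .inr .verify (V.init z) c₂ :=
        .of_init hq₂ hz₂ fun k hki =>
          (hk₂ _ (hinr hki)).congr ((hk₁ _ (hinr hki)).congr (hk k hki))
      simpa using he₂.counts Sum.inr_injective (fun _ _ => rfl) (hg z (by omega))
  | reject h =>
    refine .reject (step_of_reject ?_)
    rw [hδ he, δ_of_step_eq_reject h]
    rfl
  | next h _ ih =>
    obtain ⟨d', hd', he', hk'⟩ := he.exists_next Sum.inl_injective (hδ he) h (A := A)
    exact (Counts.next hd' (ih he' ((hk' _ (by simp)).congr hz)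
      (fun k hki => (hk' _ (by simp)).congr (hk k hki)) (by omega))).mono (by omega)
  | @branch t c d l₀ l₁ h _ _ ih₀ ih₁ =>
    obtain ⟨r, hr, rfl⟩ := δ_of_step_eq_branch h
    have h1 : (guess M V).δ c'.state c'.read = .choose fun b => .record (r b) b := by
      rw [hδ he, hr]
      rfl
    have hrec : ∀ (b : Bool) {n : ℕ}, (∀ c₂ : (guess M V).Cfg,
        Embeds (M := M) (N := guess M V) .inl .run { c with state := r b } c₂ →
        c₂.At (.inr V.inputTape) (z ++ [b]).length (.ofWord (z ++ [b])) →
        (∀ k, k ≠ V.inputTape → c₂.At (.inr k) 0 (.ofWord [])) →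
        (guess M V).Counts A (2 * t + (T + L + 2)) c₂ n) →
        (guess M V).Counts A (2 * t + (T + L + 2) + 1) { c' with state := .record (r b) b } n := by
      intro b n hn
      refine Counts.write (N := guess M V) (q := GuessState.run (r b)) hne rfl
        fun c₂ hq₂ ha₂ hz₂ hk₂ => hn c₂ ?_ (hz.snoc hz₂) fun k hki =>
          (hk₂ _ Sum.inr_ne_inl (hinr hki)).congr (hk k hki)
      have hall : ∀ k, c₂.At (.inl k) (c'.head (.inl k)) (c'.tape (.inl k)) := by
        intro k
        by_cases hki : k = M.inputTape
        · rw [hki]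
          exact ha₂.stay
        · exact hk₂ _ (fun h => hki (Sum.inl_injective h)) Sum.inl_ne_inr
      exact ⟨hq₂, fun k => (hall k).1.trans (he.head k), fun k => (hall k).2.trans (he.tape k)⟩
    have hsum : ((l₀.map (List.cons false) ++ l₁.map (List.cons true)).map
        fun y => g (z ++ y)).sum = (l₀.map fun y => g (z ++ [false] ++ y)).sum +
          (l₁.map fun y => g (z ++ [true] ++ y)).sum := by
      simp [Function.comp_def]
    rw [hsum]
    exact (Counts.branch (step_of_choose h1)
      (hrec false fun c₂ he₂ hz₂ hk₂ => ih₀ he₂ hz₂ hk₂ (by simp; omega))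
      (hrec true fun c₂ he₂ hz₂ hk₂ => ih₁ he₂ hz₂ hk₂ (by simp; omega))).mono (by omega)

/-- The encoding: of the input `u ++ v`, the part `u` has been read, and `z` is on the input tape
of `V`. -/
theorem counts_guess_tag {T n : ℕ} (v : List Bool) : ∀ (u z : List Bool) (c : (guess M V).Cfg),
    (∀ c' : (guess M V).Cfg, Embeds (N := guess M V) .inl .run (M.init (u ++ v)) c' →
      c'.At (.inr V.inputTape) (z ++ encode v []).length (.ofWord (z ++ encode v [])) →
      (∀ k, k ≠ V.inputTape → c'.At (.inr k) 0 (.ofWord [])) → (guess M V).Counts A T c' n) →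
    c.state = .tag → c.At (.inl M.inputTape) u.length (.ofWord (u ++ v)) →
    c.At (.inr V.inputTape) z.length (.ofWord z) →
    (∀ k, k ≠ .inl M.inputTape → k ≠ .inr V.inputTape → c.At k 0 (.ofWord [])) →
    (guess M V).Counts A (T + 3 * v.length + u.length + 2) c n := by
  have hne : (Sum.inl M.inputTape : M.K ⊕ V.K) ≠ .inr V.inputTape := Sum.inl_ne_inr
  have htag : ∀ (v u : List Bool) (c : (guess M V).Cfg), c.state = .tag →
      c.At (.inl M.inputTape) u.length (.ofWord (u ++ v)) →
      (guess M V).δ c.state c.read = match v.head? with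
      | some _ =>
        .write c.read (.inr V.inputTape) (some false) .right (.inl M.inputTape) .stay .bit
      | none =>
        .write c.read (.inr V.inputTape) (some true) .right (.inl M.inputTape) .left .back := by
    intro v u c hq ha
    rw [hq, ← Tape.ofWord_append_length, ← ha.read]
    rfl
  induction v with
  | nil =>
    intro u z c h hq ha hb hk
    refine Counts.mono (s := T + u.length + 1 + 1) (.write hne (htag [] u c hq ha)
      fun c₁ hq₁ ha₁ hb₁ hk₁ => .rewind (a := Sum.inl M.inputTape) (back := GuessState.back)
        (q := GuessState.run M.start) (fun _ => rfl) (u := u ++ []) (by simp) hq₁ ?_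
        fun c₂ hq₂ ha₂ hk₂ => h c₂ (.of_init hq₂ ha₂ fun k hki => ?_) ?_ fun k hki => ?_)
      (by simp)
    · rw [ha.1, ha.2] at ha₁
      exact ha₁
    · have hki' : (Sum.inl k : M.K ⊕ V.K) ≠ .inl M.inputTape := fun h => hki (Sum.inl_injective h)
      exact (hk₂ _ hki').congr ((hk₁ _ hki' Sum.inl_ne_inr).congr (hk _ hki' Sum.inl_ne_inr))
    · exact (hk₂ _ hne.symm).congr (hb.snoc hb₁)
    · have hki' : (Sum.inr k : M.K ⊕ V.K) ≠ .inr V.inputTape := fun h => hki (Sum.inr_injective h)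
      exact (hk₂ _ Sum.inr_ne_inl).congr
        ((hk₁ _ Sum.inr_ne_inl hki').congr (hk _ Sum.inr_ne_inl hki'))
  | cons b v ih =>
    intro u z c h hq ha hb hk
    refine Counts.mono (s := T + 3 * v.length + (u ++ [b]).length + 2 + 1 + 1)
      (.write hne (htag (b :: v) u c hq ha) fun c₁ hq₁ ha₁ hb₁ hk₁ => ?_) (by simp; omega)
    replace ha₁ := ha₁.stay.congr ha
    replace hb₁ := hb.snoc hb₁
    have hbit : (guess M V).δ c₁.state c₁.read =
        .write c₁.read (.inr V.inputTape) (some b) .right (.inl M.inputTape) .right .tag := by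
      have hr : c₁.read (.inl M.inputTape) = some b := by
        rw [ha₁.read, Tape.ofWord_append_length]
        rfl
      rw [hq₁, ← hr]
      rfl
    refine .write hne hbit fun c₂ hq₂ ha₂ hb₂ hk₂ =>
      ih (u ++ [b]) (z ++ [false] ++ [b]) c₂ (fun c' h₁ h₂ h₃ => h c' (by simpa using h₁)
        (by simpa using h₂) h₃) hq₂ ?_ (hb₁.snoc hb₂) fun k hka hkb =>
          (hk₂ _ hka hkb).congr ((hk₁ _ hka hkb).congr (hk _ hka hkb))
    rw [ha₁.1, ha₁.2] at ha₂
    simpa [Shift.toInt] using ha₂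

end OracleNTM

open OracleNTM in
/-- The class `#P` is closed under summation over the accepting paths of a machine. -/
theorem sum_map_mem_sharpP {M : OracleNTM} {p : ℕ[X]} {l : List Bool → List (List Bool)}
    (hl : ∀ w, M.Enumerates ∅ (p.eval w.length) (M.init w) (l w)) {h : List Bool → ℕ}
    (hh : h ∈ SharpP) : (fun w => ((l w).map fun y => h (encode w y)).sum) ∈ SharpP := by
  obtain ⟨V, hV, hh⟩ := hh
  obtain ⟨q, hq⟩ := hV.exists_counts
  refine mem_sharpPRel_of_counts (N := guess M V)
    (2 * p + (q.comp (2 * X + 1 + p) + (2 * X + 1 + p) + 2) + 3 * X + 2) fun B w =>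
      ⟨_, ?_, fun _ => rfl⟩
  have henc : ∀ y, h (encode w y) = h ([] ++ encode w [] ++ y) := fun y => by
    rw [List.nil_append, ← encode_append, List.nil_append]
  simp only [henc]
  refine Counts.mono (counts_guess_tag w [] [] _ (fun c he hb hk => counts_guess_run (hl w)
    (L := 2 * w.length + 1 + p.eval w.length) (g := h)
    (T := q.eval (2 * w.length + 1 + p.eval w.length)) (fun z hz => ?_) he hb hk ?_) rfl
    ⟨rfl, if_pos rfl⟩ ⟨rfl, if_neg Sum.inr_ne_inl⟩ fun k hka _ => ⟨rfl, if_neg hka⟩) ?_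
  · rw [hh]
    exact (hq ∅ z).mono (eval_le_eval q hz)
  · simp [length_encode]
  · simp [eval_comp]

/-! ### Sums over initial segments -/

/-- The function `φ` maps the class `#P` to itself. -/
def PreservesSharpP (φ : ℕ → ℕ) : Prop :=
  ∀ f ∈ SharpP, (fun w => φ (f w)) ∈ SharpP

theorem map_length_filter_lt {α : Type*} [Preorder α] [DecidableLT α] {l : List α}
    (hl : l.Pairwise (· < ·)) :
    (l.map fun y => (l.filter (· < y)).length) = List.range l.length := by
  induction l with
  | nil => rfl
  | cons a l ih =>
    rw [List.pairwise_cons] at hl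
    rw [List.length_cons, List.range_succ_eq_map, ← ih hl.2, List.map_cons, List.map_map]
    congr 1
    · have : l.filter (· < a) = [] := List.filter_eq_nil_iff.2 fun y hy => by
        simpa using (hl.1 y hy).not_gt
      simp [this]
    · refine List.map_congr_left fun y hy => ?_
      simp [hl.1 y hy]

/-- Summing `φ` over the positions of the accepting paths in lexicographic order gives the sum of
`φ` over an initial segment. -/
theorem PreservesSharpP.sum_range {φ : ℕ → ℕ} (hφ : PreservesSharpP φ) :
    PreservesSharpP fun n => ∑ i ∈ Finset.range n, φ i := by
  rintro f ⟨M, ⟨p, hp⟩, hf⟩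
  choose l hl using fun w => (hp ∅ w).exists_enumerates
  obtain ⟨h, hh, hpos⟩ := exists_mem_sharpP_predecessors hl
  -- the weight of the path at position `i` is `φ i`
  convert sum_map_mem_sharpP hl (hφ h hh) using 2 with w
  dsimp only
  rw [hf, (hl w).numAcc_eq, Finset.sum_range, ← List.sum_ofFn]
  have := congrArg (List.map φ) (map_length_filter_lt (hl w).pairwise_lt)
  simp only [List.map_map, Function.comp_def] at this
  simp only [hpos, this]
  congr 1
  apply List.ext_getElem <;> simp

/-! ### Indicator functions of sets in `NP` and their complements -/

namespace OracleNTM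

variable {M : OracleNTM} {A : Set (List Bool)}

theorem exists_acceptsAlong_iff (h : M.PolyTime) (w : List Bool) :
    (∃ y, M.AcceptsAlong A (M.init w) y) ↔ M.numAcc A w ≠ 0 := by
  obtain ⟨p, hp⟩ := h
  obtain ⟨l, hl⟩ := (hp A w).exists_enumerates
  simp only [hl.numAcc_eq, ← hl.mem_iff, Ne, List.length_eq_zero_iff]
  exact ⟨fun ⟨_, hy⟩ => List.ne_nil_of_mem hy, List.exists_mem_of_ne_nil l⟩

/-- The machine that asks the oracle about the input and accepts if the answer is `b`. -/
def ask (b : Bool) : OracleNTM where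
  K := Unit
  Q := Option Bool
  finiteK := inferInstance
  finiteQ := inferInstance
  inputTape := ()
  queryTape := ()
  start := none
  δ
    | none, _ => .query some
    | some x, _ => if x = b then .accept else .reject

theorem ask_answer (b : Bool) (w : List Bool) :
    (ask b).answer A ((ask b).init w) = true ↔ w ∈ A := by
  have : ((ask b).init w).tape (ask b).queryTape = .ofWord w := if_pos rfl
  simp [answer, this, Tape.holds_ofWord]

open Classical in
theorem counts_ask (b : Bool) (w : List Bool) :
    (ask b).Counts A 1 ((ask b).init w) (if w ∈ A ↔ b = true then 1 else 0) := by
  refine .next (step_of_query (r := some) rfl) ?_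
  have h : ((ask b).answer A ((ask b).init w) = b) ↔ (w ∈ A ↔ b = true) := by
    rw [← ask_answer b w, Bool.coe_iff_coe]
  split_ifs with hw
  · exact .accept (step_of_accept (if_pos (h.2 hw)))
  · exact .reject (step_of_reject (if_neg fun h' => hw (h.1 h')))

/-- The machine that rejects instead of accepting and accepts instead of rejecting. -/
def swap (M : OracleNTM) : OracleNTM where
  K := M.K
  Q := M.Q
  finiteK := M.finiteK
  finiteQ := M.finiteQ
  inputTape := M.inputTape
  queryTape := M.queryTape
  start := M.start
  δ q s :=
    match M.δ q s with
    | .accept => .reject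
    | .reject => .accept
    | a => a

theorem Deterministic.exists_counts_swap (hM : M.Deterministic) {t : ℕ} {c : M.Cfg}
    (h : M.HaltsWithin A t c) : ∃ m n, m + n = 1 ∧ M.Counts A t c m ∧
      M.swap.Counts A t ⟨c.state, c.head, c.tape⟩ n := by
  have hδ : ∀ c : M.Cfg, M.swap.δ c.state (Cfg.read (M := M.swap) ⟨c.state, c.head, c.tape⟩) =
      match M.δ c.state c.read with
      | .accept => .reject
      | .reject => .accept
      | a => a := fun _ => rfl
  induction h with
  | @accept t c h =>
    have h1 := hδ c
    rw [δ_of_step_eq_accept h] at h1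
    exact ⟨1, 0, rfl, .accept h, .reject (step_of_reject h1)⟩
  | @reject t c h =>
    have h1 := hδ c
    rw [δ_of_step_eq_reject h] at h1
    exact ⟨0, 1, rfl, .reject h, .accept (step_of_accept h1)⟩
  | @next t c c' h _ ih =>
    obtain ⟨m, n, hmn, hm, hn⟩ := ih
    refine ⟨m, n, hmn, .next h hm, ?_⟩
    have h1 := hδ c
    obtain ⟨q, write, shift, hq, rfl⟩ | ⟨r, hr, rfl⟩ := δ_of_step_eq_next h
    · rw [hq] at h1
      exact .next (step_of_move h1) hn
    · rw [hr] at h1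
      exact .next (step_of_query h1) hn
  | branch h _ _ =>
    obtain ⟨r, hr, -⟩ := δ_of_step_eq_branch h
    exact (hM _ _ _ hr).elim

end OracleNTM

open OracleNTM

theorem support_mem_classNP {f : List Bool → ℕ} (hf : f ∈ SharpP) : {w | f w ≠ 0} ∈ ClassNP := by
  obtain ⟨M, hM, hf⟩ := hf
  refine ⟨M, hM, fun w => ?_⟩
  rw [exists_acceptsAlong_iff hM, ← hf]
  rfl

/-- The indicator functions of the sets in `NP` and of their complements are in `#P`. -/
def IndicatorsInSharpP : Prop :=
  ∀ L ∈ ClassNP, L.indicator 1 ∈ SharpP ∧ Lᶜ.indicator 1 ∈ SharpP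

theorem indicatorsInSharpP_of_sharpP_eq (h : SharpP = SharpPNP) : IndicatorsInSharpP := by
  classical
  have key : ∀ L ∈ ClassNP, ∀ b : Bool,
      (fun w => if w ∈ L ↔ b = true then 1 else 0) ∈ SharpP := by
    intro L hL b
    rw [h]
    exact ⟨L, hL, mem_sharpPRel_of_counts (N := ask b) 1 fun B w =>
      ⟨_, by simpa using counts_ask b w, by rintro rfl; rfl⟩⟩
  refine fun L hL => ⟨?_, ?_⟩
  · convert key L hL true using 2 with w
    simp [Set.indicator]
  · convert key L hL false using 2 with w
    simp [Set.indicator]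

theorem indicatorsInSharpP_of_classP_eq (h : ClassP = ClassNP) : IndicatorsInSharpP := by
  intro L hL
  rw [← h] at hL
  obtain ⟨M, hdet, hM, hL⟩ := hL
  have hM' := hM
  obtain ⟨p, hp⟩ := hM'
  have key : ∀ B w, ∃ n, M.numAcc B w + n = 1 ∧
      M.swap.Counts B (p.eval w.length) (M.swap.init w) n := by
    intro B w
    obtain ⟨m, n, hmn, hm, hn⟩ := hdet.exists_counts_swap (hp B w)
    exact ⟨n, by rwa [hm.numAcc_eq], hn⟩
  refine ⟨⟨M, hM, fun w => ?_⟩, mem_sharpPRel_of_counts (N := M.swap) p fun B w => ?_⟩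
  · obtain ⟨n, hn, -⟩ := key ∅ w
    by_cases hw : w ∈ L
    · have := (exists_acceptsAlong_iff hM w).1 ((hL w).1 hw)
      simp [hw]
      omega
    · have := (exists_acceptsAlong_iff (A := ∅) hM w).not.1 fun h => hw ((hL w).2 h)
      simp [hw]
      omega
  · obtain ⟨n, hn, hn'⟩ := key B w
    refine ⟨n, hn', ?_⟩
    rintro rfl
    by_cases hw : w ∈ L
    · have := (exists_acceptsAlong_iff hM w).1 ((hL w).1 hw)
      simp [hw]
      omega
    · have := (exists_acceptsAlong_iff (A := ∅) hM w).not.1 fun h => hw ((hL w).2 h)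
      simp [hw]
      omega

/-! ### The polynomial `(x - 1)(x - 2) / 2` -/

theorem eval_binomPoly_two_comp (x : ℚ) :
    ((binomPoly 2).comp (X - 1)).eval x = (x - 1) * (x - 2) / 2 := by
  simp [binomPoly, descPochhammer_succ_right]
  ring

theorem sum_range_sum_range_sign (n : ℕ) :
    ((∑ i ∈ Finset.range (n + 1), ∑ j ∈ Finset.range i, if j = 0 then 0 else 1 : ℕ) : ℚ) =
      n * (n - 1) / 2 := by
  have h : ∀ i, ∑ j ∈ Finset.range (i + 1), (if j = 0 then 0 else 1 : ℕ) = i := by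
    intro i
    induction i with
    | zero => simp
    | succ i ih => rw [Finset.sum_range_succ, ih]; simp
  induction n with
  | zero => simp
  | succ n ih =>
    rw [Finset.sum_range_succ, Nat.cast_add, ih, h]
    push_cast
    ring

/-- For `n ≥ 1`, the sum of `i - 1` over `1 ≤ i < n` is `(n - 1)(n - 2) / 2`. The value `1` at
`n = 0` comes from the indicator function of a complement. -/
theorem isClosureProperty_of_indicatorsInSharpP (h : IndicatorsInSharpP) :
    IsClosureProperty SharpP ((binomPoly 2).comp (X - 1)) := by
  have hsign : PreservesSharpP fun n => if n = 0 then 0 else 1 := by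
    intro f hf
    convert (h _ (support_mem_classNP hf)).1 using 2 with w
    by_cases hw : f w = 0 <;> simp [hw]
  intro f hf
  refine ⟨_, add_mem_sharpP (hsign.sum_range.sum_range f hf)
    (h _ (support_mem_classNP hf)).2, fun w => ?_⟩
  rw [eval_binomPoly_two_comp]
  obtain hw | ⟨n, hw⟩ : f w = 0 ∨ ∃ n, f w = n + 1 := by
    cases f w <;> simp
  · simp [hw]
  · rw [Nat.cast_add, hw, sum_range_sum_range_sign, Set.indicator_of_notMem (by simp [hw])]
    push_cast
    ring

theorem eval_binomPoly_natCast (a n : ℕ) : (binomPoly a).eval (n : ℚ) = n.choose a := by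
  rw [binomPoly, eval_mul, eval_C, descPochhammer_eval_eq_descFactorial,
    Nat.descFactorial_eq_factorial_mul_choose, Nat.cast_mul, inv_mul_cancel_left₀]
  exact_mod_cast a.factorial_ne_zero

/-- A binomial-good polynomial is monotone on the natural numbers. -/
theorem BinomialGood.eval_natCast_le {φ : ℚ[X]} (h : BinomialGood φ) {m n : ℕ} (hmn : m ≤ n) :
    φ.eval (m : ℚ) ≤ φ.eval (n : ℚ) := by
  obtain ⟨c, rfl⟩ := h
  simp only [Finsupp.sum, eval_finsetSum, eval_mul, eval_C, eval_binomPoly_natCast]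
  gcongr

theorem binomialBad_binomPoly_two_comp : BinomialBad ((binomPoly 2).comp (X - 1)) := by
  intro h
  have := h.eval_natCast_le zero_le_one
  rw [eval_binomPoly_two_comp, eval_binomPoly_two_comp] at this
  norm_num at this

/-! ### Counting the words of a given length in the oracle -/

theorem ncard_length_succ (A : Set (List Bool)) (z : List Bool) (n : ℕ) :
    {y | y.length = n + 1 ∧ z ++ y ∈ A}.ncard =
      {y | y.length = n ∧ z ++ [false] ++ y ∈ A}.ncard +
        {y | y.length = n ∧ z ++ [true] ++ y ∈ A}.ncard := by
  have hfin : ∀ (m : ℕ) (u : List Bool), {y | y.length = m ∧ u ++ y ∈ A}.Finite := fun m u =>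
    (List.finite_length_eq Bool m).subset fun y hy => hy.1
  rw [← Set.ncard_image_of_injective {y | y.length = n ∧ z ++ [false] ++ y ∈ A}
      (List.cons_injective (a := false)),
    ← Set.ncard_image_of_injective {y | y.length = n ∧ z ++ [true] ++ y ∈ A}
      (List.cons_injective (a := true)),
    ← Set.ncard_union_eq ?_ ((hfin _ _).image _) ((hfin _ _).image _)]
  · congr 1
    ext y
    rcases y with _ | ⟨_ | _, y⟩ <;> simp
  · rw [Set.disjoint_left]
    rintro _ ⟨y, -, rfl⟩ ⟨y', -, h⟩
    simp at h

namespace OracleNTM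

variable {M : OracleNTM} {A : Set (List Bool)}

/-- The states of the machine `guessWord`. -/
inductive GuessWordState
  /-- look for another bit of the input -/
  | read
  /-- write the bit `b` of the guessed word -/
  | write (b : Bool)
  /-- accept if the answer `b` is yes -/
  | done (b : Bool)

instance : Finite GuessWordState :=
  .of_surjective (α := Option (Bool × Bool))
    (fun
      | none => .read
      | some (false, b) => .write b
      | some (true, b) => .done b)
    (by
      rintro (_ | b | b)
      exacts [⟨none, rfl⟩, ⟨some (false, b), rfl⟩, ⟨some (true, b), rfl⟩])

/-- The machine that guesses a word of the length of the input and accepts if it is in the oracle.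
Tape `false` is the input tape, tape `true` the query tape. -/
def guessWord : OracleNTM where
  K := Bool
  Q := GuessWordState
  finiteK := inferInstance
  finiteQ := inferInstance
  inputTape := false
  queryTape := true
  start := .read
  δ
    | .read, s =>
      match s false with
      | some _ => .choose .write
      | none => .query .done
    | .write b, s => .write s true (some b) .right false .right .read
    | .done true, _ => .accept
    | .done false, _ => .reject

theorem counts_guessWord (v : List Bool) : ∀ (u z : List Bool) (c : guessWord.Cfg),
    c.state = .read → c.At false u.length (.ofWord (u ++ v)) → c.At true z.length (.ofWord z) →
    guessWord.Counts A (2 * v.length + 1) c {y | y.length = v.length ∧ z ++ y ∈ A}.ncard := by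
  have hδ : ∀ (v u : List Bool) (c : guessWord.Cfg), c.state = .read →
      c.At false u.length (.ofWord (u ++ v)) → guessWord.δ c.state c.read = match v.head? with
        | some _ => .choose .write
        | none => .query .done := by
    intro v u c hq hu
    rw [hq, ← Tape.ofWord_append_length, ← hu.read]
    rfl
  induction v with
  | nil =>
    intro u z c hq hu hz
    refine .next (step_of_query (hδ [] u c hq hu)) ?_
    have hans : guessWord.answer A c = true ↔ z ∈ A := by
      have : c.tape guessWord.queryTape = .ofWord z := hz.2
      simp [answer, this, Tape.holds_ofWord]
    by_cases h : z ∈ A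
    · have : {y : List Bool | y.length = ([] : List Bool).length ∧ z ++ y ∈ A} = {[]} := by
        ext y
        simp only [List.length_nil, List.length_eq_zero_iff, Set.mem_ofPred_eq,
          Set.mem_singleton_iff, and_iff_left_iff_imp]
        rintro rfl
        simpa
      rw [this, Set.ncard_singleton, hans.2 h]
      exact .accept (step_of_accept rfl)
    · have : {y : List Bool | y.length = ([] : List Bool).length ∧ z ++ y ∈ A} = ∅ := by
        ext y
        simp only [List.length_nil, List.length_eq_zero_iff, Set.mem_ofPred_eq,
          Set.mem_empty_iff_false, iff_false, not_and]
        rintro rfl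
        simpa
      rw [this, Set.ncard_empty, Bool.eq_false_iff.2 (hans.not.2 h)]
      exact .reject (step_of_reject rfl)
  | cons b v ih =>
    intro u z c hq hu hz
    have hwrite : ∀ x : Bool, guessWord.Counts A (2 * v.length + 1 + 1)
        { c with state := .write x } {y | y.length = v.length ∧ z ++ [x] ++ y ∈ A}.ncard := by
      intro x
      refine .write (N := guessWord) (a := false) (b := true) (q := GuessWordState.read)
        Bool.false_ne_true rfl fun c' hq' hu' hz' _ =>
          ih (u ++ [b]) (z ++ [x]) c' hq' ?_ (hz.snoc hz')
      have hu'' : c'.At false (c.head false + Shift.right.toInt) (c.tape false) := hu'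
      rw [hu.1, hu.2] at hu''
      simpa [Shift.toInt] using hu''
    rw [List.length_cons, ncard_length_succ]
    exact (Counts.branch (step_of_choose (hδ (b :: v) u c hq hu)) (hwrite false)
      (hwrite true)).mono (by omega)

end OracleNTM

theorem ncard_length_mem_sharpPRel (A : Set (List Bool)) :
    (fun w : List Bool => {x | x.length = w.length ∧ x ∈ A}.ncard) ∈ SharpPRel A := by
  refine mem_sharpPRel_of_counts (N := guessWord) (2 * X + 1) fun B w =>
    ⟨{x | x.length = w.length ∧ x ∈ B}.ncard, ?_, by rintro rfl; rfl⟩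
  simpa using counts_guessWord w [] [] (guessWord.init w) rfl ⟨rfl, if_pos rfl⟩
    ⟨rfl, if_neg (Bool.false_ne_true ∘ Eq.symm)⟩

/-! ### The words that a computation asks about -/

namespace OracleNTM

variable {M : OracleNTM} {A : Set (List Bool)}

/-- A step depends on the oracle in at most one word. -/
theorem exists_step_eq (c : M.Cfg) : ∃ S : Finset (List Bool), S.card ≤ 1 ∧
    ∀ A B : Set (List Bool), (∀ x ∈ S, x ∈ A ↔ x ∈ B) → M.step A c = M.step B c := by
  have key : ∀ A B : Set (List Bool), M.answer A c = M.answer B c → M.step A c = M.step B c := by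
    intro A B h
    unfold step
    rw [h]
  by_cases hy : ∃ y, (c.tape M.queryTape).Holds y
  · obtain ⟨y, hy⟩ := hy
    refine ⟨{y}, by simp, fun A B h => key A B ?_⟩
    have h' : ∀ A : Set (List Bool), M.answer A c = true ↔ y ∈ A := fun A => by
      simp only [answer, decide_eq_true_eq]
      exact ⟨fun ⟨z, hz, hz'⟩ => hy.unique hz' ▸ hz, fun h => ⟨y, h, hy⟩⟩
    rw [Bool.eq_iff_iff, h', h']
    exact h y (by simp)
  · refine ⟨∅, by simp, fun A B _ => key A B ?_⟩
    have h' : ∀ A : Set (List Bool), M.answer A c = false := fun A => by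
      simp only [answer, decide_eq_false_iff_not]
      exact fun ⟨z, _, hz⟩ => hy ⟨z, hz⟩
    rw [h', h']

/-- The whole computation tree depends on finitely many words of the oracle. -/
theorem Enumerates.exists_finset {t : ℕ} {c : M.Cfg} {l : List (List Bool)}
    (h : M.Enumerates A t c l) : ∃ S : Finset (List Bool),
      ∀ B : Set (List Bool), (∀ x ∈ S, x ∈ A ↔ x ∈ B) → M.Enumerates B t c l := by
  classical
  induction h with
  | accept h =>
    exact ⟨∅, fun B _ => .accept (step_of_accept (δ_of_step_eq_accept h))⟩
  | reject h =>
    exact ⟨∅, fun B _ => .reject (step_of_reject (δ_of_step_eq_reject h))⟩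
  | @next t c c' l h _ ih =>
    obtain ⟨S, hS⟩ := ih
    obtain ⟨S', -, hS'⟩ := exists_step_eq c
    refine ⟨S' ∪ S, fun B hB => .next ((hS' A B fun x hx => hB x ?_).symm.trans h)
      (hS B fun x hx => hB x ?_)⟩ <;> simp [hx]
  | @branch t c d l₀ l₁ h _ _ ih₀ ih₁ =>
    obtain ⟨S₀, hS₀⟩ := ih₀
    obtain ⟨S₁, hS₁⟩ := ih₁
    obtain ⟨r, hr, rfl⟩ := δ_of_step_eq_branch h
    refine ⟨S₀ ∪ S₁, fun B hB => .branch (step_of_choose hr) (hS₀ B fun x hx => hB x ?_)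
      (hS₁ B fun x hx => hB x ?_)⟩ <;> simp [hx]

/-- An accepting path asks at most as many questions as it has steps. -/
theorem AcceptsAlong.exists_finset {t : ℕ} {c : M.Cfg} {y : List Bool}
    (hy : M.AcceptsAlong A c y) (h : M.HaltsWithin A t c) :
    ∃ S : Finset (List Bool), S.card ≤ t ∧
      ∀ B : Set (List Bool), (∀ x ∈ S, x ∈ A ↔ x ∈ B) → M.AcceptsAlong B c y := by
  classical
  induction hy generalizing t with
  | halt h' =>
    exact ⟨∅, by simp, fun B _ => .halt (step_of_accept (δ_of_step_eq_accept h'))⟩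
  | @next c c' y h' _ ih =>
    cases h with
    | accept h => simp_all
    | reject h => simp_all
    | branch h => simp_all
    | @next t _ _ h ht =>
      obtain rfl := Outcome.next.inj (h'.symm.trans h)
      obtain ⟨S, hSt, hS⟩ := ih ht
      obtain ⟨S', hS1, hS'⟩ := exists_step_eq c
      refine ⟨S' ∪ S, (Finset.card_union_le _ _).trans (by omega), fun B hB =>
        .next ((hS' A B fun x hx => hB x ?_).symm.trans h) (hS B fun x hx => hB x ?_)⟩ <;> simp [hx]
  | @branch c d y h' b _ ih =>
    cases h with
    | accept h => simp_all
    | reject h => simp_all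
    | next h => simp_all
    | @branch t _ _ h ht =>
      obtain rfl := Outcome.branch.inj (h'.symm.trans h)
      obtain ⟨S, hSt, hS⟩ := ih (ht b)
      obtain ⟨r, hr, rfl⟩ := δ_of_step_eq_branch h
      exact ⟨S, by omega, fun B hB => .branch (step_of_choose hr) b (hS B hB)⟩

/-! ### There are countably many machines -/

instance : Finite Shift :=
  .of_surjective (α := Option Bool)
    (fun
      | none => .stay
      | some false => .left
      | some true => .right)
    (by
      rintro (_ | _ | _)
      exacts [⟨some false, rfl⟩, ⟨none, rfl⟩, ⟨some true, rfl⟩])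

instance (K Q : Type) [Finite K] [Finite Q] : Finite (Action K Q) :=
  .of_surjective
    (α := Bool ⊕ (Q × (K → Option Bool) × (K → Shift)) ⊕ (Bool → Q) ⊕ (Bool → Q))
    (fun
      | .inl false => .reject
      | .inl true => .accept
      | .inr (.inl (q, w, s)) => .move q w s
      | .inr (.inr (.inl r)) => .choose r
      | .inr (.inr (.inr r)) => .query r)
    (by
      rintro (_ | _ | ⟨q, w, s⟩ | r | r)
      exacts [⟨.inl true, rfl⟩, ⟨.inl false, rfl⟩, ⟨.inr (.inl (q, w, s)), rfl⟩,
        ⟨.inr (.inr (.inl r)), rfl⟩, ⟨.inr (.inr (.inr r)), rfl⟩])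

/-- The data of a machine whose tapes and states are numbered. -/
abbrev Code : Type :=
  Σ k q : ℕ, Fin k × Fin k × Fin q × (Fin q → (Fin k → Option Bool) → Action (Fin k) (Fin q))

/-- The machine given by a code. -/
def ofCode (e : Code) : OracleNTM where
  K := Fin e.1
  Q := Fin e.2.1
  finiteK := inferInstance
  finiteQ := inferInstance
  inputTape := e.2.2.1
  queryTape := e.2.2.2.1
  start := e.2.2.2.2.1
  δ := e.2.2.2.2.2

end OracleNTM

/-- An action with renamed tapes and states. -/
def Action.rename {K Q K' Q' : Type} (e : K ≃ K') (f : Q ≃ Q') : Action K Q → Action K' Q'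
  | .accept => .accept
  | .reject => .reject
  | .move q write shift => .move (f q) (write ∘ e.symm) (shift ∘ e.symm)
  | .choose r => .choose (f ∘ r)
  | .query r => .query (f ∘ r)

namespace OracleNTM

variable {M N : OracleNTM} {A : Set (List Bool)}

/-- Machines that differ by the names of their tapes and states have the same computation trees. -/
theorem Embeds.enumerates_rename {e : M.K ≃ N.K} {f : M.Q ≃ N.Q}
    (hquery : N.queryTape = e M.queryTape)
    (hδ : ∀ q s, N.δ (f q) s = (M.δ q (s ∘ e)).rename e f) {c : M.Cfg} {c' : N.Cfg}
    (he : Embeds e f c c') {t : ℕ} {l : List (List Bool)} (h : M.Enumerates A t c l) :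
    N.Enumerates A t c' l := by
  have hδ' : ∀ {c : M.Cfg} {c' : N.Cfg}, Embeds e f c c' →
      N.δ c'.state c'.read = (M.δ c.state c.read).rename e f := by
    intro c c' he
    rw [he.state, hδ, he.read]
  induction h generalizing c' with
  | accept h =>
    refine .accept (step_of_accept ?_)
    rw [hδ' he, δ_of_step_eq_accept h, Action.rename]
  | reject h =>
    refine .reject (step_of_reject ?_)
    rw [hδ' he, δ_of_step_eq_reject h, Action.rename]
  | @next _ c₀ _ _ h _ ih =>
    have hc := hδ' he
    obtain ⟨q, write, shift, hM, rfl⟩ | ⟨r, hM, rfl⟩ := δ_of_step_eq_next h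
    · rw [hM, Action.rename] at hc
      refine .next (step_of_move hc) (ih ⟨rfl, fun k => ?_, fun k => ?_⟩)
      · simp [he.head]
      · simp [he.head, he.tape]
    · rw [hM, Action.rename] at hc
      refine .next (step_of_query hc) (ih ⟨?_, he.head, he.tape⟩)
      have hans : N.answer A c' = M.answer A c₀ := by
        rw [answer, answer, hquery, he.tape]
      exact congrArg (f ∘ r) hans
  | branch h _ _ ih₀ ih₁ =>
    obtain ⟨r, hM, rfl⟩ := δ_of_step_eq_branch h
    have hc := hδ' he
    rw [hM, Action.rename] at hc
    exact .branch (step_of_choose hc) (ih₀ ⟨rfl, he.head, he.tape⟩) (ih₁ ⟨rfl, he.head, he.tape⟩)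

/-- Every polynomial-time machine has an equivalent one with numbered tapes and states. -/
theorem exists_code (M : OracleNTM) (hM : M.PolyTime) :
    ∃ e : Code, (ofCode e).PolyTime ∧ ∀ A w, (ofCode e).numAcc A w = M.numAcc A w := by
  have := M.finiteK
  have := M.finiteQ
  obtain ⟨k, ⟨e⟩⟩ := Finite.exists_equiv_fin M.K
  obtain ⟨q, ⟨f⟩⟩ := Finite.exists_equiv_fin M.Q
  obtain ⟨p, hp⟩ := hM.exists_counts
  let c : Code := ⟨k, q, e M.inputTape, e M.queryTape, f M.start,
    fun x s => (M.δ (f.symm x) (s ∘ e)).rename e f⟩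
  have key : ∀ A w, (ofCode c).Counts A (p.eval w.length) ((ofCode c).init w) (M.numAcc A w) := by
    intro A w
    obtain ⟨l, hl, hn⟩ := hp A w
    refine ⟨l, Embeds.enumerates_rename (M := M) (N := ofCode c) (e := e) (f := f) rfl
      (fun x s => ?_) (.of_init rfl ⟨rfl, if_pos rfl⟩
        fun k hk => ⟨rfl, if_neg (e.injective.ne hk)⟩) hl, hn⟩
    have hx : f.symm (f x) = x := f.symm_apply_apply x
    exact congrArg (fun x => (M.δ x (s ∘ e)).rename e f) hx
  exact ⟨c, polyTime_of_counts p fun A w => ⟨_, key A w⟩, fun A w => (key A w).numAcc_eq⟩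

end OracleNTM

/-! ### An oracle relative to which the polynomial is no closure property -/

theorem eventually_eval_lt_two_pow (p : ℕ[X]) : ∀ᶠ n in Filter.atTop, p.eval n < 2 ^ n := by
  have h : (fun n => ((p.eval n : ℕ) : ℝ)) =o[Filter.atTop] fun n : ℕ => (2 : ℝ) ^ n := by
    induction p using Polynomial.induction_on' with
    | add p q hp hq => simpa using hp.add hq
    | monomial k a =>
      simpa using (isLittleO_pow_const_const_pow_of_one_lt k one_lt_two).const_mul_left (a : ℝ)
  filter_upwards [h.def (one_half_pos (α := ℝ))] with n hn
  have h2 : (0 : ℝ) < 2 ^ n := by positivity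
  rw [Real.norm_of_nonneg (by positivity), Real.norm_of_nonneg h2.le] at hn
  exact_mod_cast (show ((p.eval n : ℕ) : ℝ) < 2 ^ n by linarith)

/-- No machine computes `(f - 1)(f - 2) / 2` for all oracles close to a given one, where `f` is the
number of words of the length of the input in the oracle: an accepting path for `f = 0` misses
some word of this length, which can be added to the oracle to get `f = 1` without destroying
the path. -/
theorem exists_numAcc_ne {M : OracleNTM} (hM : M.PolyTime) (a : List Bool → Bool)
    (I : Finset (List Bool)) : ∃ b : List Bool → Bool, (∀ x ∈ I, b x = a x) ∧
      ∃ w, (M.numAcc {x | b x = true} w : ℚ) ≠ ((binomPoly 2).comp (X - 1)).eval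
        (({x | x.length = w.length ∧ b x = true}.ncard : ℕ) : ℚ) := by
  classical
  by_contra! hcon
  obtain ⟨p, hp⟩ := id hM
  -- a length above that of the words in `I`, at which there are more words than steps
  obtain ⟨n, hnI, hpn⟩ : ∃ n, (∀ x ∈ I, x.length < n) ∧ p.eval n < 2 ^ n := by
    obtain ⟨n, hn, hn'⟩ := ((Filter.eventually_gt_atTop (I.sup List.length)).and
      (eventually_eval_lt_two_pow p)).exists
    exact ⟨n, fun x hx => (Finset.le_sup hx).trans_lt hn, hn'⟩
  let w : List Bool := List.replicate n true
  have hw : w.length = n := List.length_replicate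
  let b : List Bool → Bool := fun x => if x ∈ I then a x else false
  have hb : ∀ x, x.length = n → b x = false := fun x hx =>
    if_neg fun hxI => (hnI x hxI).ne hx
  have hb0 : {x | x.length = w.length ∧ b x = true} = ∅ := by
    ext x
    simp +contextual [hw, hb]
  have h1 := hcon b (fun x hx => if_pos hx) w
  rw [hb0, Set.ncard_empty, eval_binomPoly_two_comp] at h1
  obtain ⟨y, hy⟩ := (exists_acceptsAlong_iff hM w).2 fun h => by
    rw [h] at h1
    norm_num at h1
  obtain ⟨S, hSc, hS⟩ := hy.exists_finset (hp _ w)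
  obtain ⟨x, hxn, hxS⟩ : ∃ x : List Bool, x.length = n ∧ x ∉ S := by
    by_contra! h
    have hsub : Finset.univ.image (List.ofFn : (Fin n → Bool) → List Bool) ⊆ S := by
      rintro x hx
      obtain ⟨v, -, rfl⟩ := Finset.mem_image.1 hx
      exact h _ List.length_ofFn
    have := Finset.card_le_card hsub
    rw [Finset.card_image_of_injective _ List.ofFn_injective, Finset.card_univ, Fintype.card_fun,
      Fintype.card_bool, Fintype.card_fin] at this
    rw [hw] at hSc
    omega
  let b' := Function.update b x true
  have hb1 : {z | z.length = w.length ∧ b' z = true} = {x} := by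
    ext z
    by_cases hz : z = x
    · simp [hz, b', hw, hxn]
    · simp +contextual [hz, b', hw, hb]
  have h2 := hcon b' (fun z hz => ?_) w
  · rw [hb1, Set.ncard_singleton, eval_binomPoly_two_comp] at h2
    refine (exists_acceptsAlong_iff hM w).1 ⟨y, hS _ fun z hz => ?_⟩ (by simpa using h2)
    have : z ≠ x := fun h => hxS (h ▸ hz)
    simp [b', this]
  · have : z ≠ x := fun h => (hnI z hz).ne (h ▸ hxn)
    simp [b', this, b, hz]

theorem not_relativizes : ¬ Relativizes ((binomPoly 2).comp (X - 1)) := by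
  intro hrel
  let F : Code → Set (List Bool → Bool) := fun e => {a | (ofCode e).PolyTime ∧
    ∀ w, ((ofCode e).numAcc {x | a x = true} w : ℚ) = ((binomPoly 2).comp (X - 1)).eval
      (({x | x.length = w.length ∧ a x = true}.ncard : ℕ) : ℚ)}
  -- the result on one input depends on finitely many words of the oracle
  have hclosed : ∀ e, IsClosed (F e) := by
    intro e
    by_cases he : (ofCode e).PolyTime
    · rw [← isOpen_compl_iff, isOpen_pi_iff]
      intro a ha
      obtain ⟨w, hw⟩ : ∃ w, ((ofCode e).numAcc {x | a x = true} w : ℚ) ≠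
          ((binomPoly 2).comp (X - 1)).eval
            (({x | x.length = w.length ∧ a x = true}.ncard : ℕ) : ℚ) := by
        by_contra! h
        exact ha ⟨he, h⟩
      obtain ⟨p, hp⟩ := id he
      obtain ⟨l, hl⟩ := (hp {x | a x = true} w).exists_enumerates
      obtain ⟨S, hS⟩ := hl.exists_finset
      classical
      refine ⟨S ∪ (List.finite_length_eq Bool w.length).toFinset, fun x => {a x},
        fun x _ => ⟨isOpen_discrete _, rfl⟩, fun b hb hbF => hw ?_⟩
      have hab : ∀ x ∈ S ∪ (List.finite_length_eq Bool w.length).toFinset, b x = a x :=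
        fun x hx => hb x hx
      have h1 := hbF.2 w
      have h2 := (hS {x | b x = true} fun x hx => by
        simp [hab x (Finset.mem_union_left _ hx)]).numAcc_eq
      have h3 : {x | x.length = w.length ∧ b x = true} =
          {x | x.length = w.length ∧ a x = true} := by
        ext x
        refine and_congr_right fun hx => ?_
        rw [hab x (Finset.mem_union_right _ (by simpa using hx))]
      rwa [h2, ← hl.numAcc_eq, h3] at h1
    · convert isClosed_empty
      exact Set.eq_empty_of_forall_notMem fun a ha => he ha.1
  have hcover : ⋃ e, F e = Set.univ := by
    refine Set.eq_univ_of_forall fun a => Set.mem_iUnion.2 ?_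
    obtain ⟨g, ⟨M, hM, hg⟩, hgφ⟩ := hrel {x | a x = true} _ (ncard_length_mem_sharpPRel _)
    obtain ⟨e, he, hn⟩ := M.exists_code hM
    exact ⟨e, he, fun w => by rw [hn, ← hg, hgφ]; rfl⟩
  obtain ⟨e, a, ha⟩ := nonempty_interior_of_iUnion_of_closed hclosed hcover
  obtain ⟨I, u, hu, hsub⟩ := isOpen_pi_iff.1 isOpen_interior a ha
  obtain ⟨b, hb, w, hw⟩ := exists_numAcc_ne (interior_subset ha).1 a I
  have hbF : b ∈ F e := interior_subset (hsub fun x hx => by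
    rw [hb x hx]
    exact (hu x hx).2)
  exact hw (hbF.2 w)

end CountingComplexity

end

theorem theorem4 :
    (CountingComplexity.UnivariateBinomialBasisConjecture →
      CountingComplexity.SharpP ≠ CountingComplexity.SharpPNP ∧
      CountingComplexity.ClassP ≠ CountingComplexity.ClassNP) ∧
    (CountingComplexity.SharpP = CountingComplexity.SharpPNP →
      CountingComplexity.IsClosureProperty CountingComplexity.SharpP
        ((CountingComplexity.binomPoly 2).comp (Polynomial.X - 1))) ∧
    CountingComplexity.BinomialBad
      ((CountingComplexity.binomPoly 2).comp (Polynomial.X - 1)) := by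
  refine ⟨fun h => ?_, fun h' => ?_, CountingComplexity.binomialBad_binomPoly_two_comp⟩
  · have key : ¬ CountingComplexity.IndicatorsInSharpP := fun hI =>
      CountingComplexity.not_relativizes
        (h _ (CountingComplexity.isClosureProperty_of_indicatorsInSharpP hI))
    exact ⟨fun h' => key (CountingComplexity.indicatorsInSharpP_of_sharpP_eq h'),
      fun h' => key (CountingComplexity.indicatorsInSharpP_of_classP_eq h')⟩
  · exact CountingComplexity.isClosureProperty_of_indicatorsInSharpP
      (CountingComplexity.indicatorsInSharpP_of_sharpP_eq h')
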